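/- Let $E$ be a Banach space with norm $\|\cdot\|$, $\Lambda$ a compact Polish space, $0<\mu<1$, $0\le\nu\le1$, $\lambda=\mu+\nu-\mu\nu$, and $0=t_0<t_1<\dots<t_n<t_{n+1}=T$. Let $A$ be the infinitesimal generator of a compact, uniformly bounded $C_0$-semigroup $Q(t)$, $t\ge0$, on $E$, and $M=\sup_{t\ge0}\|Q(t)\|$. For $\theta>0$ put $$\varpi_\mu(\theta)=\frac1\pi\sum_{m\ge1}(-1)^{m-1}\theta^{-m\mu-1}\frac{\Gamma(m\mu+1)}{m!}\sin(m\pi\mu),\qquad \xi_\mu(\theta)=\frac1\mu\,\theta^{-1-\frac1\mu}\varpi_\mu(\theta^{-\frac1\mu}),$$ $$P_\mu(t)x=\int_0^\infty\mu\theta\,\xi_\mu(\theta)\,Q(t^\mu\theta)x\,d\theta,\qquad S_{\mu,\nu}(t)x=I_{0+}^{\nu(1-\mu)}\big[s\mapsto s^{\mu-1}P_\mu(s)x\big](t),$$ where $I^{a}_{0+}f(t)=\frac1{\Gamma(a)}\int_0^t(t-s)^{a-1}f(s)\,ds$ for $a>0$ and $I^0_{0+}f=f$. Assume: * $H(g_r)$: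 $g:[0,T]\times E\times\Lambda\to E$ is such that $g(\cdot,x,\eta)$ is (strongly) measurable for all $(x,\eta)$, and, for almost every $t\in[0,T]$, $g(t,\cdot,\cdot)$ is continuous and, with $k$ such that $t\in(t_k,t_{k+1}]$, $$\|g(t,x,\eta)\|\le\alpha_r(t)+\beta_r(t-t_k)^{1-\lambda}\|x\|,\qquad \|g(t,x,\eta)-g(t,y,\eta)\|\le L_r(t-t_k)^{1-\lambda}\|x-y\|$$ for all $x,y\in E$, $\eta\in\Lambda$, where $0\le\alpha_r\in L^p([0,T])$ with $p>1/\mu$, $\beta_r\ge0$, $L_r>0$. * $H(h)$: $\phi_k:[0,T]\times E\to E$, $k=1,\dots,n$, satisfy $\|\phi_k(t_k,x)-\phi_k(t_k,y)\|\le h_k\|x-y\|$ for all $x,y\in E$, with constants $h_k>0$ such that $2M\,h_k\sum_{i=1}^k(t_i-t_{i-1})^{\lambda-1}<\Gamma(\lambda)$. A relaxed control is a function $v$ on $[0,T]$ such that $v(t)$ is a Borel probability measure on $\Lambda$ for a.e. $t$, and $t\mapsto\int_\Lambda f(\eta)\,v(t)(d\eta)$ is measurable for every $f\in C(\Lambda)$.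 Put $G_v(t,x)=\int_\Lambda g(t,x,\eta)\,v(t)(d\eta)$. The relaxed system $(P_r)$ is $$D^{\mu,\nu}_{0+}x(t)=Ax(t)+G_v(t,x(t)),\ t\ne t_k,\qquad I^{1-\lambda}_{0+}x(0)=x_0,\qquad \Delta I^{1-\lambda}_{t_k}x(t_k)=\phi_k(t_k,x(t_k^-)),\ k=1,\dots,n.$$ The space $PC_{1-\lambda}([0,T],E)$ consists of the functions $x$ on $(0,T]$ such that, for each $k=0,\dots,n$, $(t-t_k)^{1-\lambda}x(t)$ is continuous and bounded on $(t_k,t_{k+1}]$. A mild solution of $(P_r)$ is an $x\in PC_{1-\lambda}([0,T],E)$ such that for all $k=0,\dots,n$ and $t\in(t_k,t_{k+1}]$ (with the last integrand integrable on $(0,t)$) $$x(t)=S_{\mu,\nu}(t)x_0+\sum_{i=1}^kS_{\mu,\nu}(t-t_i)\phi_i(t_i,x(t_i^-))+\int_0^t(t-s)^{\mu-1}P_\mu(t-s)G_v(s,x(s))\,ds .$$ Then there are $0\le\alpha_o\in L^p([0,T])$, $\beta_o>0$, $L_o>0$, not depending on $v$, such that for every relaxed control $v$: 1. $G_v$ satisfies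 $H(g_o)$: $G_v(\cdot,x)$ is (strongly) measurable on $[0,T]$ for each $x\in E$, and for almost every $t\in[0,T]$, $G_v(t,\cdot)$ is continuous and, with $t\in(t_k,t_{k+1}]$, $\|G_v(t,x)\|\le\alpha_o(t)+\beta_o(t-t_k)^{1-\lambda}\|x\|$ and $\|G_v(t,x)-G_v(t,y)\|\le L_o(t-t_k)^{1-\lambda}\|x-y\|$ for all $x,y\in E$; 2. for every $x_0\in E$ the relaxed system $(P_r)$ has a unique mild solution in $PC_{1-\lambda}([0,T],E)$. -/

import Mathlib

open MeasureTheory Set Filter Topology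

noncomputable section

namespace HilferRelax

section Semigroup

variable {E : Type*} [NormedAddCommGroup E] [NormedSpace ℝ E]

/-- `Q(t)`, `t ≥ 0`, is a strongly continuous (`C₀`) semigroup of bounded linear operators.
The values of `Q` at negative arguments play no role. -/
structure IsC0Semigroup (Q : ℝ → E →L[ℝ] E) : Prop where
  zero : Q 0 = ContinuousLinearMap.id ℝ E
  add : ∀ s t : ℝ, 0 ≤ s → 0 ≤ t → Q (s + t) = (Q s).comp (Q t)
  continuousOn : ∀ x : E, ContinuousOn (fun t => Q t x) (Ici 0)

/-- The semigroup is compact: `Q(t)` is a compact operator for every `t > 0`. -/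
def IsCompactSemigroup (Q : ℝ → E →L[ℝ] E) : Prop :=
  ∀ t : ℝ, 0 < t → IsCompactOperator (Q t)

/-- The semigroup is uniformly bounded on `[0,∞)`. -/
def IsUniformlyBounded (Q : ℝ → E →L[ℝ] E) : Prop :=
  BddAbove (range fun t : Ici (0 : ℝ) => ‖Q t‖)

/-- `M = sup_{t ≥ 0} ‖Q(t)‖`. -/
def supNorm (Q : ℝ → E →L[ℝ] E) : ℝ := ⨆ t : Ici (0 : ℝ), ‖Q t‖

/-- The (in general unbounded) operator `A : D(A) ⊆ E → E` is the infinitesimal generator of `Q`: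
`x ∈ D(A)` and `A x = y` exactly when `(Q(h) x - x) / h → y` as `h → 0+`. -/
def IsGenerator (A : E →ₗ.[ℝ] E) (Q : ℝ → E →L[ℝ] E) : Prop :=
  ∀ x y : E, (x, y) ∈ A.graph ↔
    Tendsto (fun h : ℝ => h⁻¹ • (Q h x - x)) (𝓝[>] 0) (𝓝 y)

end Semigroup

section Kernels

variable {E : Type*} [NormedAddCommGroup E] [NormedSpace ℝ E]

/-- `λ = μ + ν - μν`. -/
def lam (μ ν : ℝ) : ℝ := μ + ν - μ * ν

/-- The function
`ϖ_μ(θ) = π⁻¹ ∑_{n ≥ 1} (-1)^(n-1) θ^(-nμ-1) Γ(nμ+1)/n! sin(nπμ)`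
(the summation index below is `n - 1`). -/
def varpi (μ θ : ℝ) : ℝ :=
  1 / Real.pi * ∑' n : ℕ, (-1 : ℝ) ^ n * θ ^ (-((n + 1 : ℕ) * μ) - 1) *
    (Real.Gamma ((n + 1 : ℕ) * μ + 1) / (Nat.factorial (n + 1) : ℝ)) *
      Real.sin ((n + 1 : ℕ) * Real.pi * μ)

/-- The density `ξ_μ(θ) = μ⁻¹ θ^(-1-1/μ) ϖ_μ(θ^(-1/μ))` on `(0,∞)`. -/
def xi (μ θ : ℝ) : ℝ := 1 / μ * θ ^ (-1 - 1 / μ) * varpi μ (θ ^ (-(1 / μ)))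

/-- `P_μ(t) x = ∫₀^∞ μ θ ξ_μ(θ) Q(t^μ θ) x dθ`. -/
def P (μ : ℝ) (Q : ℝ → E →L[ℝ] E) (t : ℝ) (x : E) : E :=
  ∫ θ in Ioi (0 : ℝ), (μ * θ * xi μ θ) • Q (t ^ μ * θ) x

/-- The Riemann–Liouville fractional integral of order `a ≥ 0`, with lower limit `0`;
the integral of order `0` is the identity. -/
def rlIntegral (a : ℝ) (f : ℝ → E) (t : ℝ) : E :=
  if a = 0 then f t
  else (1 / Real.Gamma a) • ∫ s in (0 : ℝ)..t, (t - s) ^ (a - 1) • f s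

/-- `S_{μ,ν}(t) x = I^{ν(1-μ)} [s ↦ s^(μ-1) P_μ(s) x] (t)`. -/
def S (μ ν : ℝ) (Q : ℝ → E →L[ℝ] E) (t : ℝ) (x : E) : E :=
  rlIntegral (ν * (1 - μ)) (fun s => s ^ (μ - 1) • P μ Q s x) t

end Kernels

section System

variable {E : Type*} [NormedAddCommGroup E] [NormedSpace ℝ E]

/-- `0 = t₀ < t₁ < ⋯ < tₙ < tₙ₊₁ = T`; only the values `t k` with `k ≤ n + 1` matter. -/
structure IsPartition (T : ℝ) (n : ℕ) (t : ℕ → ℝ) : Prop where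
  zero : t 0 = 0
  last : t (n + 1) = T
  lt : ∀ k ≤ n, t k < t (k + 1)

/-- `x ∈ PC_{1-l}([0,T],E)`: on each interval `(t_k, t_{k+1}]` the function
`(s - t_k)^(1-l) x(s)` is continuous, and the norm
`max_k sup_{(t_k, t_{k+1}]} (s - t_k)^(1-l) ‖x(s)‖` is finite. -/
def MemPC (l : ℝ) (n : ℕ) (t : ℕ → ℝ) (x : ℝ → E) : Prop :=
  ∀ k ≤ n,
    ContinuousOn (fun s => (s - t k) ^ (1 - l) • x s) (Ioc (t k) (t (k + 1))) ∧
    BddAbove ((fun s => (s - t k) ^ (1 - l) * ‖x s‖) '' Ioc (t k) (t (k + 1)))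

/-- `x` is a mild solution in `PC_{1-λ}([0,T],E)` of the impulsive Hilfer system
`D^{μ,ν} x(s) = A x(s) + F(s, x(s))`, `I^{1-λ} x (0) = x₀`,
`Δ I^{1-λ} x (t_k) = φ_k(t_k, x(t_k⁻))`, where `Q` is the semigroup generated by `A`:
for `s ∈ (t_k, t_{k+1}]` the integrand below is integrable on `(0,s)` and
`x(s) = S(s) x₀ + ∑_{i=1}^k S(s-t_i) φ_i(t_i, x(t_i⁻)) + ∫₀^s (s-r)^(μ-1) P(s-r) F(r,x(r)) dr`. -/
structure IsMildSolution (μ ν : ℝ) (Q : ℝ → E →L[ℝ] E) (n : ℕ) (t : ℕ → ℝ)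
    (φ : ℕ → ℝ → E → E) (F : ℝ → E → E) (x₀ : E) (x : ℝ → E) : Prop where
  memPC : MemPC (lam μ ν) n t x
  integrable : ∀ k ≤ n, ∀ s ∈ Ioc (t k) (t (k + 1)),
    IntervalIntegrable (fun r => (s - r) ^ (μ - 1) • P μ Q (s - r) (F r (x r))) volume 0 s
  eq : ∀ k ≤ n, ∀ s ∈ Ioc (t k) (t (k + 1)),
    x s = S μ ν Q s x₀
      + ∑ i ∈ Finset.Icc 1 k, S μ ν Q (s - t i) (φ i (t i) (Function.leftLim x (t i)))
      + ∫ r in (0 : ℝ)..s, (s - r) ^ (μ - 1) • P μ Q (s - r) (F r (x r))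

/-- The hypothesis `H(g_o)` on `F : [0,T] × E → E`, with data `p, α, β, L` and `l = λ`. -/
structure HypGo (l T : ℝ) (n : ℕ) (t : ℕ → ℝ) (p : ℝ) (α : ℝ → ℝ) (β L : ℝ)
    (F : ℝ → E → E) : Prop where
  measurable : ∀ x : E, AEStronglyMeasurable (fun s => F s x) (volume.restrict (Icc 0 T))
  continuous : ∀ᵐ s ∂(volume.restrict (Icc 0 T)), Continuous fun x : E => F s x
  alpha_nonneg : ∀ s ∈ Icc 0 T, 0 ≤ α s
  alpha_memLp : MemLp α (ENNReal.ofReal p) (volume.restrict (Icc 0 T))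
  beta_pos : 0 < β
  L_pos : 0 < L
  growth : ∀ᵐ s ∂(volume.restrict (Icc 0 T)), ∀ k ≤ n, s ∈ Ioc (t k) (t (k + 1)) →
    ∀ x : E, ‖F s x‖ ≤ α s + β * (s - t k) ^ (1 - l) * ‖x‖
  lipschitz : ∀ᵐ s ∂(volume.restrict (Icc 0 T)), ∀ k ≤ n, s ∈ Ioc (t k) (t (k + 1)) →
    ∀ x y : E, ‖F s x - F s y‖ ≤ L * (s - t k) ^ (1 - l) * ‖x - y‖

/-- The hypothesis `H(g_r)` on `g : [0,T] × E × Λ → E`, with data `p, α, β, L` and `l = λ`. -/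
structure HypGr {Λ : Type*} [TopologicalSpace Λ] (l T : ℝ) (n : ℕ) (t : ℕ → ℝ) (p : ℝ)
    (α : ℝ → ℝ) (β L : ℝ) (g : ℝ → E → Λ → E) : Prop where
  measurable : ∀ (x : E) (η : Λ),
    AEStronglyMeasurable (fun s => g s x η) (volume.restrict (Icc 0 T))
  continuous : ∀ᵐ s ∂(volume.restrict (Icc 0 T)), Continuous fun q : E × Λ => g s q.1 q.2
  alpha_nonneg : ∀ s ∈ Icc 0 T, 0 ≤ α s
  alpha_memLp : MemLp α (ENNReal.ofReal p) (volume.restrict (Icc 0 T))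
  beta_nonneg : 0 ≤ β
  L_pos : 0 < L
  growth : ∀ᵐ s ∂(volume.restrict (Icc 0 T)), ∀ k ≤ n, s ∈ Ioc (t k) (t (k + 1)) →
    ∀ (x : E) (η : Λ), ‖g s x η‖ ≤ α s + β * (s - t k) ^ (1 - l) * ‖x‖
  lipschitz : ∀ᵐ s ∂(volume.restrict (Icc 0 T)), ∀ k ≤ n, s ∈ Ioc (t k) (t (k + 1)) →
    ∀ (x y : E) (η : Λ), ‖g s x η - g s y η‖ ≤ L * (s - t k) ^ (1 - l) * ‖x - y‖

/-- The hypothesis `H(h)` on the impulses, with constants `h_k` and `l = λ`. The bound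
`h_k < Γ(λ) / (2 M ∑_{i=1}^k (t_i - t_{i-1})^(λ-1))` is written without the division. -/
def HypH (l : ℝ) (Q : ℝ → E →L[ℝ] E) (n : ℕ) (t : ℕ → ℝ) (φ : ℕ → ℝ → E → E)
    (h : ℕ → ℝ) : Prop :=
  ∀ k ∈ Finset.Icc 1 n,
    0 < h k ∧
    h k * (2 * supNorm Q * ∑ i ∈ Finset.Icc 1 k, (t i - t (i - 1)) ^ (l - 1)) < Real.Gamma l ∧
    ∀ x y : E, ‖φ k (t k) x - φ k (t k) y‖ ≤ h k * ‖x - y‖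

/-- `v` is a relaxed control: `v(s)` is a Borel probability measure on `Λ` for almost every
`s ∈ [0,T]`, and `s ↦ ∫ f dv(s)` is (Lebesgue) measurable on `[0,T]` for every `f ∈ C(Λ)`. -/
structure IsRelaxedControl {Λ : Type*} [TopologicalSpace Λ] [MeasurableSpace Λ] (T : ℝ)
    (v : ℝ → Measure Λ) : Prop where
  prob : ∀ᵐ s ∂(volume.restrict (Icc 0 T)), IsProbabilityMeasure (v s)
  measurable : ∀ f : C(Λ, ℝ), AEMeasurable (fun s => ∫ η, f η ∂(v s)) (volume.restrict (Icc 0 T))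

/-- The relaxed right-hand side `G_v(s,x) = ∫_Λ g(s,x,η) v(s)(dη)`. -/
def relaxedRhs {Λ : Type*} [MeasurableSpace Λ] (g : ℝ → E → Λ → E) (v : ℝ → Measure Λ)
    (s : ℝ) (x : E) : E :=
  ∫ η, g s x η ∂(v s)

end System

end HilferRelax

end

open HilferRelax

/-! Relaxation preserves the hypotheses: averaging `g` over a probability measure keeps the growth
and Lipschitz bounds, and measurability in time follows by approximating the average with finite
sums built from a partition of unity on `Λ`. So the right-hand side is a Carathéodory map, Lipschitz
in `x`, with constants independent of the control, and the task is to solve a weakly singular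
Volterra equation with impulses.

For that equation one needs only that `P_μ(s)` is a uniformly bounded, strongly continuous family.
As `Q` is bounded, this reduces to absolute integrability of `θ ξ_μ(θ)`; neither positivity of `ξ_μ`
nor its normalisation enters. The series for `ξ_μ` is alternating and hides its decay, so it is
rewritten as the imaginary part of a Laplace-type integral along a rotated ray
(`xi_eq_im_integral`). There both exponentials decay, giving a uniform bound near `0` and the decay
`θ ^ (-1 - 1/μ)` at infinity, which suffices because `1/μ > 1`.

The equation is solved interval by interval. On `(t_k, t_{k+1}]` the impulse terms involve only
values of `x` up to `t_k`, so they are known forcing. The weight `(s - t_k) ^ (1 - λ)` in the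
hypotheses cancels the singularity of `x` at `t_k`, so `F(·, x(·))` lies in `L^p`. Since `p > 1/μ`,
Hölder's inequality makes its convolution with the singular kernel continuous. A Bielecki weight
`exp(-ω s)` with `ω` large makes the solution map a contraction whatever the size of the constants
(`existsUnique_volterra`), and induction on `k` glues the pieces with uniqueness. -/

noncomputable section

namespace HilferRelax

/-! ### The Gamma integral with a complex rate -/

section GammaIntegral

/-- The measure with density `r ^ (a - 1)` on `(0, ∞)`. -/
def rpowMeasure (a : ℝ) : Measure ℝ :=
  (volume.restrict (Ioi (0 : ℝ))).withDensity fun r => ((r ^ (a - 1)).toNNReal : ENNReal)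

theorem measurable_toNNReal_rpow (a : ℝ) : Measurable fun r : ℝ => (r ^ (a - 1)).toNNReal := by
  fun_prop

theorem complexMGF_rpowMeasure (a : ℝ) (z : ℂ) :
    ProbabilityTheory.complexMGF id (rpowMeasure a) z =
      ∫ r in Ioi (0 : ℝ), ((r ^ (a - 1) : ℝ) : ℂ) * Complex.exp (z * r) := by
  rw [ProbabilityTheory.complexMGF, rpowMeasure,
    integral_withDensity_eq_integral_smul (measurable_toNNReal_rpow a)]
  refine setIntegral_congr_fun measurableSet_Ioi fun r hr => ?_
  simp only [NNReal.smul_def, id, Real.coe_toNNReal _ (Real.rpow_nonneg (le_of_lt hr) _),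
    Complex.real_smul]

theorem integrableOn_rpow_mul_exp_neg_mul {a b : ℝ} (ha : 0 < a) (hb : 0 < b) :
    IntegrableOn (fun r : ℝ => r ^ (a - 1) * Real.exp (-(b * r))) (Ioi 0) := by
  have := integrableOn_rpow_mul_exp_neg_mul_rpow (p := 1) (s := a - 1) (b := b) (by linarith)
    one_pos hb
  simpa [neg_mul] using this

theorem mem_integrableExpSet_rpowMeasure {a b : ℝ} (ha : 0 < a) (hb : b < 0) :
    b ∈ ProbabilityTheory.integrableExpSet id (rpowMeasure a) := by
  rw [ProbabilityTheory.integrableExpSet, mem_ofPred_eq, rpowMeasure,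
    integrable_withDensity_iff_integrable_smul (measurable_toNNReal_rpow a)]
  refine (integrableOn_rpow_mul_exp_neg_mul ha (neg_pos.2 hb)).congr_fun (fun r hr => ?_)
    measurableSet_Ioi
  simp [NNReal.smul_def, Real.coe_toNNReal _ (Real.rpow_nonneg (le_of_lt hr) _)]

/-- Analytic continuation in the rate: the left side is the complex moment generating function of
`rpowMeasure a` at `-c`, both sides are analytic in the half-plane, and for real rates this is the
classical formula. -/
theorem integral_rpow_mul_cexp_neg_mul {a : ℝ} (ha : 0 < a) {c : ℂ} (hc : 0 < c.re) :
    ∫ r in Ioi (0 : ℝ), ((r ^ (a - 1) : ℝ) : ℂ) * Complex.exp (-(c * r)) =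
      (1 / c) ^ (a : ℂ) * (Real.Gamma a : ℂ) := by
  set U : Set ℂ := {z | z.re < 0} with hU
  have hUo : IsOpen U := isOpen_lt Complex.continuous_re continuous_const
  have hf : AnalyticOnNhd ℂ (ProbabilityTheory.complexMGF id (rpowMeasure a)) U := by
    refine ProbabilityTheory.analyticOnNhd_complexMGF.mono fun z hz => ?_
    exact interior_maximal (fun b hb => mem_integrableExpSet_rpowMeasure ha hb) isOpen_Iio hz
  have hg : AnalyticOnNhd ℂ (fun z : ℂ => (-1 / z) ^ (a : ℂ) * (Real.Gamma a : ℂ)) U := by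
    refine DifferentiableOn.analyticOnNhd (fun z hz => ?_) hUo
    have hz0 : z ≠ 0 := by rintro rfl; simp [hU] at hz
    refine DifferentiableAt.differentiableWithinAt ?_
    refine DifferentiableAt.mul_const ?_ _
    refine DifferentiableAt.cpow_const (by fun_prop (disch := exact hz0)) ?_
    left
    rw [neg_div, one_div, Complex.neg_re, Complex.inv_re]
    have : 0 < Complex.normSq z := Complex.normSq_pos.2 hz0
    have : z.re / Complex.normSq z < 0 := div_neg_of_neg_of_pos hz this
    linarith
  have hpre : IsPreconnected U := (convex_halfSpace_re_lt 0).isPreconnected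
  -- On the negative real axis the identity is the real Gamma integral, and real points accumulate
  -- at `-1`; this is enough for the identity theorem.
  have hfreq : ∃ᶠ z in 𝓝[≠] (-1 : ℂ), ProbabilityTheory.complexMGF id (rpowMeasure a) z =
      (-1 / z) ^ (a : ℂ) * (Real.Gamma a : ℂ) := by
    have htend : Tendsto (fun x : ℝ => (x : ℂ)) (𝓝[≠] (-1 : ℝ)) (𝓝[≠] (-1 : ℂ)) := by
      refine tendsto_nhdsWithin_iff.2 ⟨?_, ?_⟩
      · have := (Complex.continuous_ofReal.tendsto (-1 : ℝ)).mono_left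
          (nhdsWithin_le_nhds (s := {-1}ᶜ))
        simpa using this
      · filter_upwards [self_mem_nhdsWithin] with x hx
        intro h
        apply hx
        have h' : (x : ℂ) = -1 := h
        exact_mod_cast h'
    refine htend.frequently (Eventually.frequently ?_)
    filter_upwards [nhdsWithin_le_nhds (Iio_mem_nhds (show (-1 : ℝ) < 0 by norm_num))] with x hx
    have hx : x < 0 := hx
    rw [complexMGF_rpowMeasure]
    have := Real.integral_rpow_mul_exp_neg_mul_Ioi ha (neg_pos.2 hx)
    have h2 : (-1 / (x : ℂ)) = ((1 / (-x) : ℝ) : ℂ) := by push_cast; rw [div_neg, neg_div]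
    rw [h2, ← Complex.ofReal_cpow (by have := neg_pos.2 hx; positivity), ← Complex.ofReal_mul,
      ← this, ← integral_complex_ofReal]
    refine setIntegral_congr_fun measurableSet_Ioi fun r _ => ?_
    simp
  have := hf.eqOn_of_preconnected_of_frequently_eq hg hpre
    (show (-1 : ℂ) ∈ U by simp [hU]) hfreq (show -c ∈ U by simpa [hU] using hc)
  rw [complexMGF_rpowMeasure] at this
  simpa [neg_div_neg_eq] using this

end GammaIntegral

/-! ### Integral representation, bounds and integrability of the density `ξ_μ` -/

section Wright

/-- The rotation angle `β = μ π (1 - μ / 2)`, which lies in `(0, π / 2)`. -/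
def wrightArg (μ : ℝ) : ℝ := μ * (Real.pi - μ * Real.pi / 2)

/-- `exp (i β)`. -/
def wrightRot (μ : ℝ) : ℂ := Complex.exp (wrightArg μ * Complex.I)

/-- `exp (- i μ π / 2)`. -/
def wrightSlope (μ : ℝ) : ℂ := Complex.exp ((-(μ * Real.pi / 2) : ℝ) * Complex.I)

/-- The integrand of the rotated integral representation of `xi`. -/
def wrightKernel (μ θ r : ℝ) : ℂ :=
  wrightRot μ * ((r ^ (μ - 1) : ℝ) : ℂ) *
    Complex.exp (-((θ * r ^ μ : ℝ) : ℂ) * wrightRot μ) * Complex.exp (-(wrightSlope μ * r))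

variable {μ : ℝ}

theorem norm_wrightRot : ‖wrightRot μ‖ = 1 := Complex.norm_exp_ofReal_mul_I _

theorem norm_wrightSlope : ‖wrightSlope μ‖ = 1 := Complex.norm_exp_ofReal_mul_I _

theorem wrightSlope_re_pos (hμ₀ : 0 < μ) (hμ₁ : μ < 1) : 0 < (wrightSlope μ).re := by
  rw [wrightSlope, Complex.exp_ofReal_mul_I_re, Real.cos_neg]
  have := Real.pi_pos
  exact Real.cos_pos_of_mem_Ioo ⟨by nlinarith, by nlinarith⟩

/-- The condition `β < π / 2` amounts to `2μ - μ² < 1`, that is `(1 - μ)² > 0`. Without the rotation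
the angle would be `μπ`, whose cosine is negative for `μ > 1/2`. -/
theorem wrightRot_re_pos (hμ₀ : 0 < μ) (hμ₁ : μ < 1) : 0 < (wrightRot μ).re := by
  rw [wrightRot, Complex.exp_ofReal_mul_I_re, wrightArg]
  have := Real.pi_pos
  have h1 : 0 < μ * (1 - μ / 2) := mul_pos hμ₀ (by linarith)
  refine Real.cos_pos_of_mem_Ioo ⟨by nlinarith, ?_⟩
  have h2 : 0 < (1 - μ) ^ 2 := by nlinarith
  nlinarith

/-- Sublinearity of `r ^ μ`: the two terms `θ r ^ μ` and `b r` balance at the threshold `R`. It lets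
`exp(-b r)` absorb the growth of `exp(θ r ^ μ)` in the domination below. -/
theorem rpow_le_mul_add (hμ₀ : 0 < μ) (hμ₁ : μ < 1) {θ b : ℝ} (hθ : 0 < θ) (hb : 0 < b) :
    ∃ C : ℝ, ∀ r : ℝ, 0 < r → θ * r ^ μ ≤ b * r + C := by
  set R : ℝ := (θ / b) ^ (1 / (1 - μ)) with hR
  have hRpos : 0 < R := Real.rpow_pos_of_pos (by positivity) _
  refine ⟨θ * R ^ μ, fun r hr => ?_⟩
  rcases le_total r R with h | h
  · have h1 : r ^ μ ≤ R ^ μ := Real.rpow_le_rpow hr.le h hμ₀.le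
    nlinarith [mul_pos hb hr]
  · have h1 : R ^ (1 - μ) ≤ r ^ (1 - μ) := Real.rpow_le_rpow hRpos.le h (by linarith)
    have h2 : R ^ (1 - μ) = θ / b := by
      rw [hR, ← Real.rpow_mul (by positivity), one_div_mul_cancel (by linarith), Real.rpow_one]
    have h3 : r ^ (1 - μ) * r ^ μ = r := by
      rw [← Real.rpow_add hr]; simp
    have h4 : θ ≤ b * r ^ (1 - μ) := by
      rw [h2, div_le_iff₀ hb] at h1; linarith
    have h5 : 0 < r ^ μ := Real.rpow_pos_of_pos hr _
    have h6 : 0 < R ^ μ := Real.rpow_pos_of_pos hRpos _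
    calc θ * r ^ μ ≤ b * r ^ (1 - μ) * r ^ μ := by gcongr
      _ = b * r := by rw [mul_assoc, h3]
      _ ≤ _ := by nlinarith [mul_pos hθ h6]

theorem xi_eq_tsum (hμ₀ : 0 < μ) {θ : ℝ} (hθ : 0 < θ) :
    xi μ θ = 1 / Real.pi * ∑' n : ℕ, (-θ) ^ n / (n.factorial : ℝ) *
      (Real.Gamma ((n + 1 : ℕ) * μ) * Real.sin ((n + 1 : ℕ) * Real.pi * μ)) := by
  rw [xi, varpi, mul_left_comm, ← tsum_mul_left]
  congr 1
  refine tsum_congr fun n => ?_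
  have hn : (0 : ℝ) < ((n + 1 : ℕ) : ℝ) * μ := by positivity
  rw [Real.Gamma_add_one hn.ne', ← Real.rpow_mul hθ.le, Nat.factorial_succ]
  have h1 : θ ^ (-1 - 1 / μ) * θ ^ (-(1 / μ) * (-(((n + 1 : ℕ) : ℝ) * μ) - 1)) = θ ^ n := by
    rw [← Real.rpow_add hθ, ← Real.rpow_natCast]
    congr 1
    push_cast
    field_simp
    ring
  rw [neg_pow θ n, ← h1]
  push_cast
  field_simp

/-- Each coefficient `Γ((n+1)μ) sin((n+1)πμ)` is the imaginary part of a Gamma integral: the factor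
`exp(i(n+1)πμ)` splits into the power `ζ ^ (n+1)` and the factor `c ^ (-(n+1)μ)` that the complex
rate produces. Summing the exponential series under the integral gives the kernel. -/
theorem xi_eq_im_integral (hμ₀ : 0 < μ) (hμ₁ : μ < 1) {θ : ℝ} (hθ : 0 < θ) :
    xi μ θ = 1 / Real.pi * (∫ r in Ioi (0 : ℝ), wrightKernel μ θ r).im := by
  set c := wrightSlope μ with hc
  set ζ := wrightRot μ with hζ
  have hcre : 0 < c.re := wrightSlope_re_pos hμ₀ hμ₁
  have hrpow : ∀ (n : ℕ) (r : ℝ), 0 < r →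
      r ^ (((n + 1 : ℕ) : ℝ) * μ - 1) = r ^ (μ - 1) * (r ^ μ) ^ n := by
    intro n r hr
    rw [← Real.rpow_natCast, ← Real.rpow_mul hr.le, ← Real.rpow_add hr]
    congr 1
    push_cast
    ring
  have hexp : ∀ r : ℝ, ‖Complex.exp (-(c * r))‖ = Real.exp (-(c.re * r)) := by
    intro r; rw [Complex.norm_exp]; simp
  let F : ℕ → ℝ → ℂ := fun n r => ζ ^ (n + 1) * (((-θ) ^ n / (n.factorial : ℝ) : ℝ) : ℂ) *
    (((r ^ (((n + 1 : ℕ) : ℝ) * μ - 1) : ℝ) : ℂ) * Complex.exp (-(c * r)))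
  let bound : ℕ → ℝ → ℝ := fun n r =>
    (r ^ (μ - 1) * Real.exp (-(c.re * r))) * ((θ * r ^ μ) ^ n / (n.factorial : ℝ))
  have hbsum : ∀ r : ℝ, HasSum (fun n => bound n r)
      ((r ^ (μ - 1) * Real.exp (-(c.re * r))) * Real.exp (θ * r ^ μ)) := by
    intro r
    refine HasSum.mul_left _ ?_
    rw [Real.exp_eq_exp_ℝ]
    exact NormedSpace.expSeries_div_hasSum_exp (θ * r ^ μ)
  have key : HasSum (fun n => ∫ r in Ioi (0 : ℝ), F n r) (∫ r in Ioi (0 : ℝ), wrightKernel μ θ r) := by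
    refine hasSum_integral_of_dominated_convergence bound (fun n => ?_) (fun n => ?_) ?_ ?_ ?_
    · refine Measurable.aestronglyMeasurable ?_
      fun_prop
    · filter_upwards [ae_restrict_mem measurableSet_Ioi] with r hr
      have hr : 0 < r := hr
      simp only [F, bound]
      rw [norm_mul, norm_mul, norm_mul, norm_pow, norm_wrightRot, hexp, Complex.norm_real,
        Complex.norm_real, hrpow n r hr, one_pow, one_mul, norm_div, norm_pow, norm_neg]
      have h1 : 0 < r ^ μ := Real.rpow_pos_of_pos hr _
      have h2 : 0 < r ^ (μ - 1) := Real.rpow_pos_of_pos hr _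
      rw [Real.norm_of_nonneg hθ.le, Real.norm_of_nonneg (by positivity),
        Real.norm_of_nonneg (by positivity), mul_pow]
      apply le_of_eq
      ring
    · exact Eventually.of_forall fun r => (hbsum r).summable
    · simp_rw [fun r => (hbsum r).tsum_eq]
      -- Half of the decay rate `c.re` pays for `exp(θ r ^ μ)`; the other half keeps the dominating
      -- function integrable.
      obtain ⟨C, hC⟩ := rpow_le_mul_add hμ₀ hμ₁ hθ (half_pos hcre)
      refine Integrable.mono' (((integrableOn_rpow_mul_exp_neg_mul hμ₀
        (half_pos hcre))).mul_const (Real.exp C)) ?_ ?_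
      · refine Measurable.aestronglyMeasurable ?_
        fun_prop
      · filter_upwards [ae_restrict_mem measurableSet_Ioi] with r hr
        have hr : 0 < r := hr
        have h2 : 0 < r ^ (μ - 1) := Real.rpow_pos_of_pos hr _
        rw [Real.norm_of_nonneg (by positivity), mul_assoc, mul_assoc, ← Real.exp_add,
          ← Real.exp_add]
        refine mul_le_mul_of_nonneg_left (Real.exp_le_exp.2 ?_) h2.le
        have := hC r hr
        linarith
    · filter_upwards [ae_restrict_mem measurableSet_Ioi] with r hr
      have hr : 0 < r := hr
      have h1 : HasSum (fun n : ℕ => (-((θ * r ^ μ : ℝ) : ℂ) * ζ) ^ n / (n.factorial : ℂ))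
          (Complex.exp (-((θ * r ^ μ : ℝ) : ℂ) * ζ)) := by
        rw [Complex.exp_eq_exp_ℂ]
        exact NormedSpace.expSeries_div_hasSum_exp _
      have h2 := (h1.mul_left (ζ * ((r ^ (μ - 1) : ℝ) : ℂ))).mul_right (Complex.exp (-(c * r)))
      refine h2.congr_fun fun n => ?_
      simp only [F]
      rw [hrpow n r hr]
      push_cast
      ring
  have hval : ∀ n : ℕ, (∫ r in Ioi (0 : ℝ), F n r).im = (-θ) ^ n / (n.factorial : ℝ) *
      (Real.Gamma ((n + 1 : ℕ) * μ) * Real.sin ((n + 1 : ℕ) * Real.pi * μ)) := by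
    intro n
    have hn : (0 : ℝ) < ((n + 1 : ℕ) : ℝ) * μ := by positivity
    simp only [F]
    rw [integral_const_mul, integral_rpow_mul_cexp_neg_mul hn hcre]
    have h1 : (1 / c) ^ (((((n + 1 : ℕ) : ℝ) * μ : ℝ)) : ℂ) =
        Complex.exp ((((n + 1 : ℕ) : ℝ) * μ * (μ * Real.pi / 2) : ℝ) * Complex.I) := by
      have hone : 1 / c = Complex.exp (((μ * Real.pi / 2 : ℝ) : ℂ) * Complex.I) := by
        rw [hc, wrightSlope, one_div, ← Complex.exp_neg]
        congr 1
        push_cast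
        ring
      have hpi := Real.pi_pos
      -- The principal logarithm returns the exponent itself because `μπ/2` lies in `(-π, π]`.
      rw [hone, Complex.cpow_def_of_ne_zero (Complex.exp_ne_zero _), Complex.log_exp]
      · congr 1
        push_cast
        ring
      · simp
        nlinarith
      · simp
        nlinarith
    have h2 : ζ ^ (n + 1) * (1 / c) ^ (((((n + 1 : ℕ) : ℝ) * μ : ℝ)) : ℂ) =
        Complex.exp ((((n + 1 : ℕ) : ℝ) * Real.pi * μ : ℝ) * Complex.I) := by
      rw [h1, hζ, wrightRot, ← Complex.exp_nat_mul, ← Complex.exp_add, wrightArg]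
      congr 1
      push_cast
      ring
    have h3 : ζ ^ (n + 1) * (((-θ) ^ n / (n.factorial : ℝ) : ℝ) : ℂ) *
        ((1 / c) ^ (((((n + 1 : ℕ) : ℝ) * μ : ℝ)) : ℂ) *
          (Real.Gamma (((n + 1 : ℕ) : ℝ) * μ) : ℂ)) =
        (((-θ) ^ n / (n.factorial : ℝ) * Real.Gamma (((n + 1 : ℕ) : ℝ) * μ) : ℝ) : ℂ) *
          Complex.exp ((((n + 1 : ℕ) : ℝ) * Real.pi * μ : ℝ) * Complex.I) := by
      rw [← h2, Complex.ofReal_mul ((-θ) ^ n / (n.factorial : ℝ))]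
      ring
    rw [h3, Complex.im_ofReal_mul, Complex.exp_ofReal_mul_I_im]
    ring
  rw [xi_eq_tsum hμ₀ hθ]
  congr 1
  have := (Complex.hasSum_im key).tsum_eq
  rw [← this]
  exact (tsum_congr hval).symm

theorem norm_wrightKernel {θ r : ℝ} (hr : 0 < r) :
    ‖wrightKernel μ θ r‖ = r ^ (μ - 1) * Real.exp (-(θ * r ^ μ * (wrightRot μ).re)) *
      Real.exp (-((wrightSlope μ).re * r)) := by
  rw [wrightKernel, norm_mul, norm_mul, norm_mul, norm_wrightRot, Complex.norm_exp,
    Complex.norm_exp, Complex.norm_real, Real.norm_of_nonneg (Real.rpow_nonneg hr.le _), one_mul]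
  congr 2
  · congr 1
    rw [← Complex.ofReal_neg, Complex.re_ofReal_mul, neg_mul]
  · simp

theorem measurable_wrightKernel : Measurable (Function.uncurry (wrightKernel μ)) := by
  unfold Function.uncurry wrightKernel
  fun_prop

/-- The factor containing `θ` has modulus at most `1`, since `wrightRot μ` has positive real part;
what remains is integrable and free of `θ`. -/
theorem abs_xi_le_const (hμ₀ : 0 < μ) (hμ₁ : μ < 1) :
    ∃ C : ℝ, ∀ θ : ℝ, 0 < θ → |xi μ θ| ≤ C := by
  refine ⟨1 / Real.pi * ∫ r in Ioi (0 : ℝ),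
    r ^ (μ - 1) * Real.exp (-((wrightSlope μ).re * r)), fun θ hθ => ?_⟩
  rw [xi_eq_im_integral hμ₀ hμ₁ hθ, abs_mul, abs_of_pos (by have := Real.pi_pos; positivity)]
  refine mul_le_mul_of_nonneg_left ?_ (by have := Real.pi_pos; positivity)
  refine (Complex.abs_im_le_norm _).trans ?_
  refine norm_integral_le_of_norm_le
    (integrableOn_rpow_mul_exp_neg_mul hμ₀ (wrightSlope_re_pos hμ₀ hμ₁)) ?_
  filter_upwards [ae_restrict_mem measurableSet_Ioi] with r hr
  have hr : 0 < r := hr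
  have h1 : 0 < r ^ μ := Real.rpow_pos_of_pos hr _
  have h2 : 0 < r ^ (μ - 1) := Real.rpow_pos_of_pos hr _
  have h3 := wrightRot_re_pos hμ₀ hμ₁
  rw [norm_wrightKernel hr]
  gcongr
  refine mul_le_of_le_one_right h2.le (Real.exp_le_one_iff.2 ?_)
  have : 0 < θ * r ^ μ * (wrightRot μ).re := by positivity
  linarith

theorem norm_exp_neg_sub_one_le {w : ℂ} (hw : 0 ≤ w.re) : ‖Complex.exp (-w) - 1‖ ≤ 2 * ‖w‖ := by
  rcases le_total ‖w‖ 1 with h | h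
  · simpa using Complex.norm_exp_sub_one_le (x := -w) (by simpa using h)
  · have : ‖Complex.exp (-w)‖ ≤ 1 := by
      rw [Complex.norm_exp]; exact Real.exp_le_one_iff.2 (by simpa using hw)
    calc _ ≤ ‖Complex.exp (-w)‖ + ‖(1 : ℂ)‖ := norm_sub_le _ _
      _ ≤ 1 + 1 := by simpa using this
      _ ≤ _ := by linarith

/-- Dropping `exp(-c r)` from the kernel leaves an integral that is real, so it is invisible in the
imaginary part. The difference gains a factor `r`, and scaling `r ^ μ` by `θ` turns `∫ r ^ μ exp(-θ
Re(ζ) r ^ μ) dr` into the stated power. -/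
theorem abs_xi_le_rpow (hμ₀ : 0 < μ) (hμ₁ : μ < 1) :
    ∃ C : ℝ, ∀ θ : ℝ, 0 < θ → |xi μ θ| ≤ C * θ ^ (-(μ + 1) / μ) := by
  set ζ := wrightRot μ with hζ
  set c := wrightSlope μ with hc
  have hζre : 0 < ζ.re := wrightRot_re_pos hμ₀ hμ₁
  have hcre : 0 < c.re := wrightSlope_re_pos hμ₀ hμ₁
  refine ⟨1 / Real.pi * (2 * (ζ.re ^ (-(μ + 1) / μ) * (1 / μ) * Real.Gamma ((μ + 1) / μ))),
    fun θ hθ => ?_⟩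
  let K₀ : ℝ → ℂ := fun r => ζ * ((r ^ (μ - 1) : ℝ) : ℂ) *
    Complex.exp (-((θ * r ^ μ : ℝ) : ℂ) * ζ)
  have hre : (-(θ * ζ) : ℂ).re < 0 := by simp; positivity
  have hK₀ : ∀ r : ℝ, K₀ r = (ζ / μ) *
      ((|μ| * r ^ (μ - 1)) • Complex.exp (-(θ * ζ) * (r ^ μ : ℝ))) := by
    intro r
    have : (μ : ℂ) ≠ 0 := by exact_mod_cast hμ₀.ne'
    simp only [K₀, abs_of_pos hμ₀, Complex.real_smul]
    push_cast
    field_simp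
  have hK₀int : IntegrableOn K₀ (Ioi 0) := by
    rw [funext hK₀]
    refine Integrable.const_mul ?_ _
    exact (integrableOn_Ioi_comp_rpow_iff (fun y : ℝ => Complex.exp (-(θ * ζ) * y)) hμ₀.ne').2
      (integrableOn_exp_mul_complex_Ioi hre 0)
  -- The substitution `y = r ^ μ` gives `(ζ/μ) ∫ exp(-θ ζ y) dy`, in which the rotation `ζ` cancels.
  have hK₀val : ∫ r in Ioi (0 : ℝ), K₀ r = ((1 / (μ * θ) : ℝ) : ℂ) := by
    rw [funext hK₀, integral_const_mul,
      integral_comp_rpow_Ioi (fun y : ℝ => Complex.exp (-(θ * ζ) * y)) hμ₀.ne',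
      integral_exp_mul_complex_Ioi hre 0]
    have h1 : (μ : ℂ) ≠ 0 := by exact_mod_cast hμ₀.ne'
    have h2 : (θ : ℂ) ≠ 0 := by exact_mod_cast hθ.ne'
    have h3 : ζ ≠ 0 := Complex.exp_ne_zero _
    simp
    field_simp
  have hbint := integrableOn_rpow_mul_exp_neg_mul_rpow (p := μ) (s := μ) (b := θ * ζ.re)
    (by linarith) hμ₀ (by positivity)
  have hdiff : ∀ r : ℝ, 0 < r → ‖wrightKernel μ θ r - K₀ r‖ ≤
      2 * (r ^ μ * Real.exp (-(θ * ζ.re) * r ^ μ)) := by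
    intro r hr
    have h1 : wrightKernel μ θ r - K₀ r = K₀ r * (Complex.exp (-(c * r)) - 1) := by
      simp only [K₀, wrightKernel, hζ, hc]; ring
    have h2 : ‖K₀ r‖ = r ^ (μ - 1) * Real.exp (-(θ * ζ.re) * r ^ μ) := by
      simp only [K₀]
      rw [norm_mul, norm_mul, norm_wrightRot, Complex.norm_exp, Complex.norm_real,
        Real.norm_of_nonneg (Real.rpow_nonneg hr.le _), one_mul, ← Complex.ofReal_neg,
        Complex.re_ofReal_mul]
      congr 2
      ring
    have h3 : ‖Complex.exp (-(c * r)) - 1‖ ≤ 2 * r := by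
      have := norm_exp_neg_sub_one_le (w := c * r) (by simp; positivity)
      rwa [norm_mul, hc, norm_wrightSlope, Complex.norm_real, Real.norm_of_nonneg hr.le,
        one_mul] at this
    rw [h1, norm_mul, h2]
    have h4 : 0 < r ^ (μ - 1) := Real.rpow_pos_of_pos hr _
    calc _ ≤ r ^ (μ - 1) * Real.exp (-(θ * ζ.re) * r ^ μ) * (2 * r) := by gcongr
      _ = 2 * ((r ^ (μ - 1) * r) * Real.exp (-(θ * ζ.re) * r ^ μ)) := by ring
      _ = _ := by rw [← Real.rpow_add_one hr.ne']; simp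
  have hKint : IntegrableOn (fun r => wrightKernel μ θ r - K₀ r) (Ioi 0) := by
    refine Integrable.mono' (hbint.const_mul 2) ?_ ?_
    · refine Measurable.aestronglyMeasurable ?_
      refine (measurable_wrightKernel.comp measurable_prodMk_left).sub ?_
      simp only [K₀]
      fun_prop
    · filter_upwards [ae_restrict_mem measurableSet_Ioi] with r hr using hdiff r hr
  have hsplit : ∫ r in Ioi (0 : ℝ), wrightKernel μ θ r =
      (∫ r in Ioi (0 : ℝ), (wrightKernel μ θ r - K₀ r)) + ((1 / (μ * θ) : ℝ) : ℂ) := by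
    rw [← hK₀val, ← integral_add hKint hK₀int]
    simp
  rw [xi_eq_im_integral hμ₀ hμ₁ hθ, hsplit, Complex.add_im, Complex.ofReal_im, add_zero, abs_mul,
    abs_of_pos (by have := Real.pi_pos; positivity), mul_assoc]
  refine mul_le_mul_of_nonneg_left ?_ (by have := Real.pi_pos; positivity)
  refine (Complex.abs_im_le_norm _).trans ?_
  have h5 : ‖∫ r in Ioi (0 : ℝ), (wrightKernel μ θ r - K₀ r)‖ ≤
      ∫ r in Ioi (0 : ℝ), 2 * (r ^ μ * Real.exp (-(θ * ζ.re) * r ^ μ)) := by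
    refine norm_integral_le_of_norm_le (hbint.const_mul 2) ?_
    filter_upwards [ae_restrict_mem measurableSet_Ioi] with r hr using hdiff r hr
  refine h5.trans (le_of_eq ?_)
  rw [integral_const_mul, integral_rpow_mul_exp_neg_mul_rpow hμ₀ (by linarith) (by positivity),
    Real.mul_rpow hθ.le hζre.le]
  ring

theorem aestronglyMeasurable_xi (hμ₀ : 0 < μ) (hμ₁ : μ < 1) :
    AEStronglyMeasurable (xi μ) (volume.restrict (Ioi 0)) := by
  have h : StronglyMeasurable fun θ => ∫ r in Ioi (0 : ℝ), wrightKernel μ θ r :=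
    StronglyMeasurable.integral_prod_right measurable_wrightKernel.stronglyMeasurable
  have h2 : Measurable fun θ => 1 / Real.pi * (∫ r in Ioi (0 : ℝ), wrightKernel μ θ r).im :=
    (Complex.measurable_im.comp h.measurable).const_mul _
  refine h2.aestronglyMeasurable.congr ?_
  filter_upwards [ae_restrict_mem measurableSet_Ioi] with θ hθ
  exact (xi_eq_im_integral hμ₀ hμ₁ hθ).symm

/-- The Wright-type density `θ ↦ μ θ ξ_μ(θ)` is integrable on `(0, ∞)`. -/
theorem integrableOn_mul_xi (hμ₀ : 0 < μ) (hμ₁ : μ < 1) :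
    IntegrableOn (fun θ => μ * θ * xi μ θ) (Ioi 0) := by
  have hmeas : AEStronglyMeasurable (fun θ => μ * θ * xi μ θ) (volume.restrict (Ioi 0)) :=
    AEStronglyMeasurable.mul (by fun_prop) (aestronglyMeasurable_xi hμ₀ hμ₁)
  obtain ⟨C₁, hC₁⟩ := abs_xi_le_const hμ₀ hμ₁
  obtain ⟨C₂, hC₂⟩ := abs_xi_le_rpow hμ₀ hμ₁
  rw [← Ioc_union_Ioi_eq_Ioi (zero_le_one (α := ℝ))]
  refine IntegrableOn.union ?_ ?_
  · refine Integrable.mono' (g := fun _ => μ * C₁) (integrable_const _)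
      (hmeas.mono_measure (Measure.restrict_mono Ioc_subset_Ioi_self le_rfl)) ?_
    filter_upwards [ae_restrict_mem measurableSet_Ioc] with θ hθ
    have h1 := hC₁ θ hθ.1
    have h2 := (abs_nonneg _).trans h1
    rw [norm_mul, norm_mul, Real.norm_of_nonneg hμ₀.le, Real.norm_of_nonneg hθ.1.le,
      Real.norm_eq_abs]
    calc μ * θ * |xi μ θ| ≤ μ * 1 * C₁ := by
          have := hθ.1; have := hθ.2; gcongr
      _ = _ := by ring
  · have hlt : -(1 / μ) < -1 := by
      rw [neg_lt_neg_iff]; exact (one_lt_div hμ₀).2 hμ₁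
    refine Integrable.mono' ((integrableOn_Ioi_rpow_of_lt hlt one_pos).const_mul (μ * C₂))
      (hmeas.mono_measure (Measure.restrict_mono (Ioi_subset_Ioi zero_le_one) le_rfl)) ?_
    filter_upwards [ae_restrict_mem measurableSet_Ioi] with θ hθ
    have hθ0 : 0 < θ := zero_lt_one.trans hθ
    rw [norm_mul, norm_mul, Real.norm_of_nonneg hμ₀.le, Real.norm_of_nonneg hθ0.le,
      Real.norm_eq_abs]
    calc μ * θ * |xi μ θ| ≤ μ * θ * (C₂ * θ ^ (-(μ + 1) / μ)) := by gcongr; exact hC₂ θ hθ0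
      _ = μ * C₂ * (θ ^ (-(μ + 1) / μ) * θ) := by ring
      _ = _ := by
        rw [← Real.rpow_add_one hθ0.ne']
        congr 2
        field_simp
        ring

end Wright

/-! ### The operator families `P_μ` and `S_{μ,ν}` -/

section Operators

variable {E : Type*} [NormedAddCommGroup E] [NormedSpace ℝ E] {μ : ℝ} {Q : ℝ → E →L[ℝ] E}

theorem norm_le_supNorm (hQb : IsUniformlyBounded Q) {s : ℝ} (hs : 0 ≤ s) : ‖Q s‖ ≤ supNorm Q :=
  le_ciSup (f := fun t : Ici (0 : ℝ) => ‖Q t‖) hQb ⟨s, hs⟩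

theorem supNorm_nonneg (hQb : IsUniformlyBounded Q) : 0 ≤ supNorm Q :=
  (norm_nonneg _).trans (norm_le_supNorm hQb le_rfl)

theorem norm_smul_semigroup_le (hQb : IsUniformlyBounded Q) {s θ : ℝ} (hs : 0 ≤ s) (hθ : 0 < θ)
    (x : E) : ‖(μ * θ * xi μ θ) • Q (s ^ μ * θ) x‖ ≤
      |μ * θ * xi μ θ| * (supNorm Q * ‖x‖) := by
  rw [norm_smul, Real.norm_eq_abs]
  have h1 : 0 ≤ s ^ μ * θ := mul_nonneg (Real.rpow_nonneg hs _) hθ.le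
  gcongr
  exact (Q (s ^ μ * θ)).le_of_opNorm_le (norm_le_supNorm hQb h1) x

theorem aestronglyMeasurable_smul_semigroup (hμ₀ : 0 < μ) (hμ₁ : μ < 1) (hQ : IsC0Semigroup Q)
    {s : ℝ} (hs : 0 ≤ s) (x : E) :
    AEStronglyMeasurable (fun θ => (μ * θ * xi μ θ) • Q (s ^ μ * θ) x)
      (volume.restrict (Ioi 0)) := by
  refine (integrableOn_mul_xi hμ₀ hμ₁).aestronglyMeasurable.smul ?_
  refine ContinuousOn.aestronglyMeasurable ?_ measurableSet_Ioi
  refine (hQ.continuousOn x).comp (by fun_prop) fun θ hθ => ?_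
  exact mul_nonneg (Real.rpow_nonneg hs _) (le_of_lt hθ)

theorem integrableOn_smul_semigroup (hμ₀ : 0 < μ) (hμ₁ : μ < 1) (hQ : IsC0Semigroup Q)
    (hQb : IsUniformlyBounded Q) {s : ℝ} (hs : 0 ≤ s) (x : E) :
    IntegrableOn (fun θ => (μ * θ * xi μ θ) • Q (s ^ μ * θ) x) (Ioi 0) := by
  refine Integrable.mono' ((integrableOn_mul_xi hμ₀ hμ₁).abs.mul_const (supNorm Q * ‖x‖))
    (aestronglyMeasurable_smul_semigroup hμ₀ hμ₁ hQ hs x) ?_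
  filter_upwards [ae_restrict_mem measurableSet_Ioi] with θ hθ
  exact norm_smul_semigroup_le hQb hs hθ x

/-- `P_μ(s)`, `s ≥ 0`, is a bounded family of continuous linear operators, strongly continuous
in `s`. -/
theorem exists_continuousLinearMap_eq_P (hμ₀ : 0 < μ) (hμ₁ : μ < 1) (hQ : IsC0Semigroup Q)
    (hQb : IsUniformlyBounded Q) :
    ∃ (R : ℝ → E →L[ℝ] E) (C : ℝ), 0 ≤ C ∧ (∀ s, 0 ≤ s → ∀ x, P μ Q s x = R s x) ∧
      (∀ s, ‖R s‖ ≤ C) ∧ ∀ x, Continuous fun s => R s x := by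
  set C : ℝ := (∫ θ in Ioi (0 : ℝ), |μ * θ * xi μ θ|) * supNorm Q with hC
  have hbound : ∀ (s : ℝ), 0 ≤ s → ∀ x, ‖P μ Q s x‖ ≤ C * ‖x‖ := by
    intro s hs x
    rw [hC, mul_assoc, ← integral_mul_const]
    refine norm_integral_le_of_norm_le ((integrableOn_mul_xi hμ₀ hμ₁).abs.mul_const _) ?_
    filter_upwards [ae_restrict_mem measurableSet_Ioi] with θ hθ
    exact norm_smul_semigroup_le hQb hs hθ x
  have hC0 : 0 ≤ C :=
    mul_nonneg (integral_nonneg fun _ => abs_nonneg _) (supNorm_nonneg hQb)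
  -- Freezing the argument at `0` for negative times gives a family bounded and strongly continuous
  -- on all of `ℝ`, so no domain conditions are needed later.
  let R : ℝ → E →L[ℝ] E := fun s => LinearMap.mkContinuous
    { toFun := fun x => P μ Q (max s 0) x
      map_add' := fun x y => by
        simp only [P, map_add, smul_add]
        exact integral_add (integrableOn_smul_semigroup hμ₀ hμ₁ hQ hQb (le_max_right _ _) x)
          (integrableOn_smul_semigroup hμ₀ hμ₁ hQ hQb (le_max_right _ _) y)
      map_smul' := fun c x => by
        simp only [P, map_smul, RingHom.id_apply]
        rw [← integral_smul]
        refine integral_congr_ae (Eventually.of_forall fun θ => ?_)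
        exact smul_comm _ _ _ } C (fun x => hbound _ (le_max_right _ _) x)
  refine ⟨R, C, hC0, fun s hs x => ?_, fun s => ?_, fun x => ?_⟩
  · change _ = P μ Q (max s 0) x
    rw [max_eq_left hs]
  · exact LinearMap.mkContinuous_norm_le _ hC0 _
  · change Continuous fun s => P μ Q (max s 0) x
    unfold P
    refine continuous_of_dominated
      (fun s => aestronglyMeasurable_smul_semigroup hμ₀ hμ₁ hQ (le_max_right _ _) x)
      (fun s => ?_) ((integrableOn_mul_xi hμ₀ hμ₁).abs.mul_const (supNorm Q * ‖x‖)) ?_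
    · filter_upwards [ae_restrict_mem measurableSet_Ioi] with θ hθ
      exact norm_smul_semigroup_le hQb (le_max_right _ _) hθ x
    · filter_upwards [ae_restrict_mem measurableSet_Ioi] with θ hθ
      refine Continuous.const_smul ?_ _
      refine (hQ.continuousOn x).comp_continuous ?_ fun s => ?_
      · exact ((continuous_id.max continuous_const).rpow_const fun _ => Or.inr hμ₀.le).mul
          continuous_const
      · exact mul_nonneg (Real.rpow_nonneg (le_max_right _ _) _) (le_of_lt hθ)

theorem intervalIntegrable_beta {a b : ℝ} (ha : 0 < a) (hb : 0 < b) :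
    IntervalIntegrable (fun u : ℝ => (1 - u) ^ (a - 1) * u ^ (b - 1)) volume 0 1 := by
  have h := Complex.betaIntegral_convergent (u := b) (v := a) (by simpa) (by simpa)
  rw [intervalIntegrable_iff_integrableOn_Ioc_of_le zero_le_one] at h ⊢
  refine (Integrable.re h).congr ?_
  filter_upwards [ae_restrict_mem measurableSet_Ioc] with u hu
  have h1 : ((u : ℂ)) ^ ((b : ℂ) - 1) * (1 - (u : ℂ)) ^ ((a : ℂ) - 1) =
      (((1 - u) ^ (a - 1) * u ^ (b - 1) : ℝ) : ℂ) := by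
    rw [Complex.ofReal_mul, Complex.ofReal_cpow (by linarith [hu.2]),
      Complex.ofReal_cpow hu.1.le]
    push_cast
    ring
  rw [h1]
  simp

/-- `S_{μ,ν}(s) x = s ^ (λ - 1) W(s)` with `W` continuous and bounded. -/
theorem exists_eq_rpow_smul_S {ν : ℝ} (hμ₀ : 0 < μ) (hμ₁ : μ < 1) (hν₀ : 0 ≤ ν)
    (hQ : IsC0Semigroup Q) (hQb : IsUniformlyBounded Q) (x : E) :
    ∃ (W : ℝ → E) (D : ℝ), Continuous W ∧ (∀ s, ‖W s‖ ≤ D) ∧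
      ∀ s, 0 < s → S μ ν Q s x = s ^ (lam μ ν - 1) • W s := by
  obtain ⟨R, C, hC0, hPR, hRC, hRcont⟩ := exists_continuousLinearMap_eq_P hμ₀ hμ₁ hQ hQb
  rcases eq_or_ne (ν * (1 - μ)) 0 with h0 | h0
  · refine ⟨fun s => R s x, C * ‖x‖, hRcont x, fun s => (R s).le_of_opNorm_le (hRC s) x,
      fun s hs => ?_⟩
    have hlam : lam μ ν = μ := by rw [lam]; linarith
    simp only [S, rlIntegral, h0, if_true, hPR s hs.le, hlam]
  · set a := ν * (1 - μ) with ha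
    have hapos : 0 < a := lt_of_le_of_ne (mul_nonneg hν₀ (by linarith)) (Ne.symm h0)
    have hlam : lam μ ν = μ + a := by rw [lam, ha]; ring
    have hbeta := intervalIntegrable_beta hapos hμ₀
    have hle : ∀ s u : ℝ, u ∈ Ioc (0 : ℝ) 1 →
        ‖((1 - u) ^ (a - 1) * u ^ (μ - 1)) • R (s * u) x‖ ≤
          (1 - u) ^ (a - 1) * u ^ (μ - 1) * (C * ‖x‖) := by
      intro s u hu
      have h1 : 0 ≤ (1 - u) ^ (a - 1) := Real.rpow_nonneg (by linarith [hu.2]) _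
      have h2 : 0 ≤ u ^ (μ - 1) := Real.rpow_nonneg hu.1.le _
      rw [norm_smul, Real.norm_of_nonneg (mul_nonneg h1 h2)]
      gcongr
      exact (R (s * u)).le_of_opNorm_le (hRC _) x
    refine ⟨fun s => (1 / Real.Gamma a) •
      ∫ u in (0 : ℝ)..1, ((1 - u) ^ (a - 1) * u ^ (μ - 1)) • R (s * u) x,
      ‖1 / Real.Gamma a‖ * ∫ u in (0 : ℝ)..1, (1 - u) ^ (a - 1) * u ^ (μ - 1) * (C * ‖x‖),
      ?_, fun s => ?_, fun s hs => ?_⟩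
    · refine Continuous.const_smul ?_ _
      refine intervalIntegral.continuous_of_dominated_interval
        (bound := fun u => (1 - u) ^ (a - 1) * u ^ (μ - 1) * (C * ‖x‖)) (fun s => ?_)
        (fun s => ?_) (hbeta.mul_const _) ?_
      · rw [uIoc_of_le zero_le_one]
        refine AEStronglyMeasurable.smul (Measurable.aestronglyMeasurable (by fun_prop)) ?_
        exact ((hRcont x).comp (by fun_prop : Continuous fun u : ℝ => s * u)).aestronglyMeasurable
      · rw [uIoc_of_le zero_le_one]
        exact Eventually.of_forall fun u hu => hle s u hu
      · refine Eventually.of_forall fun u _ => ?_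
        exact ((hRcont x).comp (by fun_prop : Continuous fun s : ℝ => s * u)).const_smul _
    · rw [norm_smul]
      gcongr
      refine intervalIntegral.norm_integral_le_of_norm_le zero_le_one ?_ (hbeta.mul_const _)
      exact Eventually.of_forall fun u hu => hle s u hu
    · simp only [S, rlIntegral, ← ha, if_neg h0]
      rw [smul_comm]
      congr 1
      -- The substitution `r = s u` moves the dependence on `s` out of the singular weights; the
      -- powers of `s` collect to `s ^ (λ - 1)`.
      have h1 := intervalIntegral.smul_integral_comp_mul_left (a := 0) (b := 1)
        (fun r => (s - r) ^ (a - 1) • (r ^ (μ - 1) • P μ Q r x)) s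
      rw [mul_zero, mul_one] at h1
      rw [← h1, ← intervalIntegral.integral_smul, ← intervalIntegral.integral_smul]
      refine intervalIntegral.integral_congr_ae ?_
      rw [uIoc_of_le zero_le_one]
      refine Eventually.of_forall fun u hu => ?_
      have hu0 : 0 ≤ u := hu.1.le
      have hu1 : 0 ≤ 1 - u := by linarith [hu.2]
      have h2 : s * s ^ (a - 1) * s ^ (μ - 1) = s ^ (lam μ ν - 1) := by
        rw [mul_comm s, ← Real.rpow_add_one hs.ne', ← Real.rpow_add hs, hlam]
        congr 1
        ring
      have h3 : s - s * u = s * (1 - u) := by ring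
      rw [hPR _ (mul_nonneg hs.le hu0), h3, Real.mul_rpow hs.le hu1, Real.mul_rpow hs.le hu0, ← h2,
        smul_smul, smul_smul, smul_smul]
      congr 1
      ring

end Operators

/-! ### Measurability of superpositions -/

section Caratheodory

variable {Ω X G : Type*} [MeasurableSpace Ω] {m : Measure Ω} [TopologicalSpace X]
  [TopologicalSpace G]

/-- Superposition with a Carathéodory function preserves strong measurability. -/
theorem aestronglyMeasurable_superposition [AddCommMonoid G] [ContinuousAdd G]
    [TopologicalSpace.PseudoMetrizableSpace G] {F : Ω → X → G}
    (hF : ∀ x, AEStronglyMeasurable (fun s => F s x) m) (hFc : ∀ᵐ s ∂m, Continuous (F s))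
    {x : Ω → X} (hx : AEStronglyMeasurable x m) :
    AEStronglyMeasurable (fun s => F s (x s)) m := by
  obtain ⟨y, hy, hxy⟩ := hx
  -- For a simple function the superposition is a finite sum over its fibres; continuity in `x` then
  -- passes to limits of simple functions.
  have hsimple : ∀ f : SimpleFunc Ω X, AEStronglyMeasurable (fun s => F s (f s)) m := by
    intro f
    have heq : (fun s => F s (f s)) =
        fun s => ∑ c ∈ f.range, (f ⁻¹' {c}).indicator (fun s => F s c) s := by
      funext s
      classical
      rw [Finset.sum_eq_single (f s)]
      · simp
      · intro b _ hb
        exact indicator_of_notMem (fun h => hb h.symm) _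
      · intro h
        exact absurd (f.mem_range_self s) h
    rw [heq]
    refine Finset.aestronglyMeasurable_fun_sum _ fun c _ => ?_
    exact (hF c).indicator (f.measurableSet_fiber c)
  have hlim : AEStronglyMeasurable (fun s => F s (y s)) m := by
    refine aestronglyMeasurable_of_tendsto_ae atTop (fun k => hsimple (hy.approx k)) ?_
    filter_upwards [hFc] with s hs
    exact (hs.tendsto _).comp (hy.tendsto_approx s)
  refine hlim.congr ?_
  filter_upwards [hxy] with s hs
  rw [hs]

end Caratheodory

/-! ### The relaxed right-hand side satisfies `H(g_o)` -/

section Relaxed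

variable {E : Type*} [NormedAddCommGroup E] [NormedSpace ℝ E]
  {Λ : Type*} [TopologicalSpace Λ] [CompactSpace Λ] [PolishSpace Λ] [MeasurableSpace Λ]
  [BorelSpace Λ]

theorem integrable_of_continuous_compactSpace {E : Type*} [NormedAddCommGroup E] {f : Λ → E} (hf : Continuous f) (m : Measure Λ)
    [IsProbabilityMeasure m] : Integrable f m := by
  obtain ⟨C, hC⟩ := isCompact_univ.exists_bound_of_continuousOn hf.continuousOn
  exact Integrable.of_bound hf.aestronglyMeasurable C (Eventually.of_forall fun x => hC x trivial)

/-- On a compact metrizable space, continuous functions are uniformly approximated by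
`∑ fᵢ • u(ηᵢ)` with partitions of unity `(fᵢ)` and points `ηᵢ` not depending on `u`. -/
theorem exists_partition_approx (Λ : Type*) [MetricSpace Λ] [CompactSpace Λ] (δ : ℝ) (hδ : 0 < δ) :
    ∃ (s : Finset Λ) (f : Λ → C(Λ, ℝ)), (∀ i η, 0 ≤ f i η) ∧ (∀ η, ∑ i ∈ s, f i η = 1) ∧
      ∀ i η, f i η ≠ 0 → dist η i < δ := by
  obtain ⟨s, hs⟩ := isCompact_univ.elim_finite_subcover (fun i : Λ => Metric.ball i δ)
    (fun i => Metric.isOpen_ball) (fun η _ => mem_iUnion.2 ⟨η, Metric.mem_ball_self hδ⟩)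
  let w : Λ → C(Λ, ℝ) := fun i => ⟨fun η => max (δ - dist η i) 0, by fun_prop⟩
  have hw0 : ∀ i η, 0 ≤ w i η := fun i η => le_max_right _ _
  have hwpos : ∀ η, 0 < ∑ i ∈ s, w i η := by
    intro η
    obtain ⟨i, hi, hη⟩ := mem_iUnion₂.1 (hs (mem_univ η))
    refine Finset.sum_pos' (fun i _ => hw0 i η) ⟨i, hi, ?_⟩
    exact lt_max_of_lt_left (sub_pos.2 hη)
  refine ⟨s, fun i => ⟨fun η => w i η / ∑ j ∈ s, w j η, ?_⟩, fun i η => ?_, fun η => ?_,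
    fun i η h => ?_⟩
  · exact (w i).continuous.div (continuous_finsetSum _ fun j _ => (w j).continuous)
      fun η => (hwpos η).ne'
  · exact div_nonneg (hw0 i η) (hwpos η).le
  · simp only [ContinuousMap.coe_mk]
    rw [← Finset.sum_div, div_self (hwpos η).ne']
  · by_contra hlt
    apply h
    have : w i η = 0 := max_eq_right (by linarith [not_lt.1 hlt])
    simp [this]

/-- A relaxed control is only tested against scalar functions independent of time. Partitions of
unity reduce the integral to finite sums `∑ (∫ fᵢ dv(s)) • u(s, ηᵢ)`, measurable termwise, which
converge for a.e. `s` by uniform continuity of `u(s, ·)` on the compact space. -/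
theorem aestronglyMeasurable_integral_relaxed [CompleteSpace E] {T : ℝ} {v : ℝ → Measure Λ}
    (hv : IsRelaxedControl T v) {u : ℝ → Λ → E}
    (hu : ∀ η, AEStronglyMeasurable (fun s => u s η) (volume.restrict (Icc 0 T)))
    (huc : ∀ᵐ s ∂(volume.restrict (Icc 0 T)), Continuous (u s)) :
    AEStronglyMeasurable (fun s => ∫ η, u s η ∂(v s)) (volume.restrict (Icc 0 T)) := by
  let _ : MetricSpace Λ := TopologicalSpace.metrizableSpaceMetric Λ
  choose s f hf0 hf1 hfd using fun k : ℕ =>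
    exists_partition_approx Λ (1 / ((k : ℝ) + 1)) (by positivity)
  refine aestronglyMeasurable_of_tendsto_ae atTop
    (f := fun k r => ∑ i ∈ s k, (∫ η, f k i η ∂(v r)) • u r i) (fun k => ?_) ?_
  · refine Finset.aestronglyMeasurable_fun_sum _ fun i _ => ?_
    exact (hv.measurable (f k i)).aestronglyMeasurable.smul (hu i)
  · filter_upwards [hv.prob, huc] with r hr hcont
    have hunif : UniformContinuous (u r) := CompactSpace.uniformContinuous_of_continuous hcont
    rw [Metric.tendsto_atTop]
    intro ε hε
    obtain ⟨δ, hδ, hδu⟩ := Metric.uniformContinuous_iff.1 hunif (ε / 2) (half_pos hε)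
    obtain ⟨N, hN⟩ := exists_nat_one_div_lt hδ
    refine ⟨N, fun k hk => ?_⟩
    have hkδ : 1 / ((k : ℝ) + 1) < δ := by
      refine lt_of_le_of_lt ?_ hN
      have : (N : ℝ) ≤ k := by exact_mod_cast hk
      gcongr
    have hint : ∀ i, Integrable (fun η => f k i η • u r i) (v r) := fun i =>
      integrable_of_continuous_compactSpace ((f k i).continuous.smul continuous_const) _
    have h1 : ∑ i ∈ s k, (∫ η, f k i η ∂(v r)) • u r i =
        ∫ η, ∑ i ∈ s k, f k i η • u r i ∂(v r) := by
      rw [integral_finsetSum _ fun i _ => hint i]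
      exact Finset.sum_congr rfl fun i _ => (integral_smul_const _ _).symm
    rw [h1, dist_eq_norm, ← integral_sub (integrable_finsetSum _ fun i _ => hint i)
      (integrable_of_continuous_compactSpace hcont _)]
    refine lt_of_le_of_lt (norm_integral_le_of_norm_le_const (C := ε / 2)
      (Eventually.of_forall fun η => ?_)) (by simpa using half_lt_self hε)
    -- Expanding `u r η` in the same partition of unity makes the error a convex combination of
    -- differences over points closer than `δ`.
    have h2 : u r η = ∑ i ∈ s k, f k i η • u r η := by
      rw [← Finset.sum_smul, hf1, one_smul]
    rw [h2, ← Finset.sum_sub_distrib]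
    calc ‖∑ i ∈ s k, (f k i η • u r i - f k i η • u r η)‖
        ≤ ∑ i ∈ s k, f k i η * (ε / 2) := by
          refine norm_sum_le_of_le _ fun i _ => ?_
          rw [← smul_sub, norm_smul, Real.norm_of_nonneg (hf0 k i η)]
          by_cases h0 : f k i η = 0
          · simp [h0]
          · refine mul_le_mul_of_nonneg_left ?_ (hf0 k i η)
            rw [← dist_eq_norm, dist_comm]
            exact (hδu ((hfd k i η h0).trans hkδ)).le
      _ = ε / 2 := by rw [← Finset.sum_mul, hf1, one_mul]

theorem IsPartition.monotone {T : ℝ} {n : ℕ} {t : ℕ → ℝ} (ht : IsPartition T n t) {i j : ℕ}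
    (hij : i ≤ j) (hj : j ≤ n + 1) : t i ≤ t j := by
  induction j, hij using Nat.le_induction with
  | base => exact le_rfl
  | succ j hij ih => exact (ih (by omega)).trans (ht.lt j (by omega)).le

theorem IsPartition.exists_mem_Ioc {T : ℝ} {n : ℕ} {t : ℕ → ℝ} (ht : IsPartition T n t) {s : ℝ}
    (hs : s ∈ Ioc 0 T) : ∃ k ≤ n, s ∈ Ioc (t k) (t (k + 1)) := by
  have h : ∀ m ≤ n + 1, s ≤ t m → ∃ k, k + 1 ≤ m ∧ s ∈ Ioc (t k) (t (k + 1)) := by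
    intro m hm
    induction m with
    | zero => intro h; rw [ht.zero] at h; exact absurd hs.1 (not_lt.2 h)
    | succ m ih =>
      intro h
      rcases le_or_gt s (t m) with h' | h'
      · obtain ⟨k, hk, hks⟩ := ih (by omega) h'
        exact ⟨k, by omega, hks⟩
      · exact ⟨m, le_rfl, h', h⟩
  obtain ⟨k, hk, hks⟩ := h (n + 1) le_rfl (by rw [ht.last]; exact hs.2)
  exact ⟨k, by omega, hks⟩

theorem ae_mem_Ioc_of_Icc (T : ℝ) : ∀ᵐ s ∂(volume.restrict (Icc 0 T)), s ∈ Ioc 0 T := by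
  rw [← restrict_Ioc_eq_restrict_Icc]
  exact ae_restrict_mem measurableSet_Ioc

theorem HypGr.relaxedRhs [CompleteSpace E] {l T p β L : ℝ} {n : ℕ} {t : ℕ → ℝ} {α : ℝ → ℝ}
    {g : ℝ → E → Λ → E} (ht : IsPartition T n t) (hg : HypGr l T n t p α β L g)
    {v : ℝ → Measure Λ} (hv : IsRelaxedControl T v) :
    HypGo l T n t p α (β + 1) L (relaxedRhs g v) := by
  have hcontη : ∀ᵐ s ∂(volume.restrict (Icc 0 T)), ∀ x, Continuous (g s x) := by
    filter_upwards [hg.continuous] with s hs x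
    exact hs.comp (by fun_prop : Continuous fun η : Λ => (x, η))
  have hlip : ∀ᵐ s ∂(volume.restrict (Icc 0 T)), ∀ k ≤ n, s ∈ Ioc (t k) (t (k + 1)) →
      ∀ x y : E, ‖HilferRelax.relaxedRhs g v s x - HilferRelax.relaxedRhs g v s y‖ ≤
        L * (s - t k) ^ (1 - l) * ‖x - y‖ := by
    filter_upwards [hg.lipschitz, hcontη, hv.prob] with s hs hc hprob k hk hsk x y
    rw [HilferRelax.relaxedRhs, HilferRelax.relaxedRhs,
      ← integral_sub (integrable_of_continuous_compactSpace (hc x) _)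
        (integrable_of_continuous_compactSpace (hc y) _)]
    simpa using norm_integral_le_of_norm_le_const (μ := v s)
      (Eventually.of_forall fun η => hs k hk hsk x y η)
  -- `β + 1` replaces `β` because `H(g_o)` asks for a strictly positive constant.
  refine ⟨fun x => ?_, ?_, hg.alpha_nonneg, hg.alpha_memLp, by linarith [hg.beta_nonneg],
    hg.L_pos, ?_, hlip⟩
  · refine aestronglyMeasurable_integral_relaxed hv (hg.measurable x) ?_
    filter_upwards [hcontη] with s hs using hs x
  -- Continuity in `x` comes from the Lipschitz bound on the subinterval containing `s`; only the
  -- null set `{0}` lies in none of them.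
  · filter_upwards [hlip, ae_mem_Ioc_of_Icc T] with s hs hsT
    obtain ⟨k, hk, hsk⟩ := ht.exists_mem_Ioc hsT
    refine LipschitzWith.continuous (K := (L * (s - t k) ^ (1 - l)).toNNReal)
      (LipschitzWith.of_dist_le_mul fun x y => ?_)
    rw [dist_eq_norm, dist_eq_norm, Real.coe_toNNReal]
    · exact hs k hk hsk x y
    · exact mul_nonneg hg.L_pos.le (Real.rpow_nonneg (by linarith [hsk.1]) _)
  · filter_upwards [hg.growth, hcontη, hv.prob] with s hs hc hprob k hk hsk x
    have h1 : ‖HilferRelax.relaxedRhs g v s x‖ ≤ α s + β * (s - t k) ^ (1 - l) * ‖x‖ := by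
      simpa [HilferRelax.relaxedRhs] using norm_integral_le_of_norm_le_const (μ := v s)
        (Eventually.of_forall fun η => hs k hk hsk x η)
    have h2 : 0 ≤ (s - t k) ^ (1 - l) := Real.rpow_nonneg (by linarith [hsk.1]) _
    refine h1.trans ?_
    gcongr
    linarith

end Relaxed

/-! ### Convolution with the weakly singular kernel -/

section Convolution

variable {E : Type*} [NormedAddCommGroup E] [NormedSpace ℝ E] {μ p T C : ℝ}
  {R : ℝ → E →L[ℝ] E} {h : ℝ → E}

theorem integrableOn_sub_rpow {κ c s : ℝ} (hκ : -1 < κ) (hcs : c ≤ s) :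
    IntegrableOn (fun r : ℝ => (s - r) ^ κ) (Ioc c s) ∧
      ∫ r in Ioc c s, (s - r) ^ κ = (s - c) ^ (κ + 1) / (κ + 1) := by
  constructor
  · rw [← intervalIntegrable_iff_integrableOn_Ioc_of_le hcs]
    have := (intervalIntegral.intervalIntegrable_rpow' (a := s - c) (b := 0) hκ).comp_sub_left s
    simpa using this
  · rw [← intervalIntegral.integral_of_le hcs,
      intervalIntegral.integral_comp_sub_left (fun u : ℝ => u ^ κ) s, sub_self,
      integral_rpow (Or.inl hκ), Real.zero_rpow (by linarith), sub_zero]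

/-- Hölder's inequality for the weakly singular kernel `(s - r) ^ (μ - 1)`. -/
theorem exists_integral_sub_rpow_mul_le {E : Type*} [NormedAddCommGroup E] {h : ℝ → E}
    (hμ₀ : 0 < μ) (hμ₁ : μ < 1) (hp : 1 / μ < p)
    (hh : MemLp h (ENNReal.ofReal p) (volume.restrict (Ioc 0 T))) :
    ∃ B γ : ℝ, 0 ≤ B ∧ 0 < γ ∧ ∀ c s, 0 ≤ c → c ≤ s → s ≤ T →
      IntegrableOn (fun r => (s - r) ^ (μ - 1) * ‖h r‖) (Ioc c s) ∧
      ∫ r in Ioc c s, (s - r) ^ (μ - 1) * ‖h r‖ ≤ B * (s - c) ^ γ := by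
  have hp1 : 1 < p := ((one_lt_div hμ₀).2 hμ₁).trans hp
  set q := p / (p - 1) with hq
  have hpq : p.HolderConjugate q := Real.HolderConjugate.conjExponent hp1
  have hq0 : 0 < q := hpq.symm.pos
  -- The condition `p > 1/μ` is precisely what makes the kernel locally `q`-integrable for the
  -- conjugate exponent `q`.
  have hκ : -1 < (μ - 1) * q := by
    rw [hq, ← mul_div_assoc, lt_div_iff₀ (by linarith)]
    rw [div_lt_iff₀ hμ₀] at hp
    nlinarith
  set κ := (μ - 1) * q with hκdef
  set A := ∫ r in Ioc 0 T, ‖h r‖ ^ p with hA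
  have hA0 : 0 ≤ A := integral_nonneg fun r => by positivity
  refine ⟨A ^ (1 / p) * (1 / (κ + 1)) ^ (1 / q), (κ + 1) * (1 / q), by
    have : 0 < κ + 1 := by linarith
    positivity, by
    have : 0 < κ + 1 := by linarith
    positivity, fun c s hc hcs hs => ?_⟩
  have hsub : Ioc c s ⊆ Ioc 0 T := Ioc_subset_Ioc hc hs
  have hh' : MemLp h (ENNReal.ofReal p) (volume.restrict (Ioc c s)) :=
    hh.mono_measure (Measure.restrict_mono hsub le_rfl)
  obtain ⟨hi, hival⟩ := integrableOn_sub_rpow hκ hcs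
  have hpow : ∀ r ∈ Ioc c s, ((s - r) ^ (μ - 1)) ^ q = (s - r) ^ κ := fun r hr => by
    rw [hκdef, Real.rpow_mul (by linarith [hr.2])]
  have hk : MemLp (fun r : ℝ => (s - r) ^ (μ - 1)) (ENNReal.ofReal q)
      (volume.restrict (Ioc c s)) := by
    rw [← integrable_norm_rpow_iff (Measurable.aestronglyMeasurable (by fun_prop))
      (by simpa using hq0) ENNReal.ofReal_ne_top, ENNReal.toReal_ofReal hq0.le]
    refine Integrable.congr hi ?_
    filter_upwards [ae_restrict_mem measurableSet_Ioc] with r hr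
    rw [Real.norm_of_nonneg (Real.rpow_nonneg (by linarith [hr.2]) _), hpow r hr]
  have : ENNReal.HolderTriple (ENNReal.ofReal p) (ENNReal.ofReal q) 1 :=
    hpq.ennrealOfReal
  refine ⟨?_, ?_⟩
  · have := (hh'.norm.integrable_mul hk)
    refine this.congr (Eventually.of_forall fun r => ?_)
    simp [mul_comm]
  · have h1 := integral_mul_le_Lp_mul_Lq_of_nonneg hpq
      (Eventually.of_forall fun r => norm_nonneg (h r))
      (f := fun r => ‖h r‖) (g := fun r => (s - r) ^ (μ - 1))
      (by
        filter_upwards [ae_restrict_mem measurableSet_Ioc] with r hr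
        exact Real.rpow_nonneg (by linarith [hr.2]) _) hh'.norm hk
    have h2 : ∫ r in Ioc c s, ((s - r) ^ (μ - 1)) ^ q = (s - c) ^ (κ + 1) / (κ + 1) := by
      rw [← hival]
      exact setIntegral_congr_fun measurableSet_Ioc hpow
    have h3 : ∫ r in Ioc c s, ‖h r‖ ^ p ≤ A := by
      refine setIntegral_mono_set ?_ (Eventually.of_forall fun r => by positivity)
        (LE.le.eventuallyLE hsub)
      have := hh.integrable_norm_rpow (by simpa using hpq.pos) ENNReal.ofReal_ne_top
      rwa [ENNReal.toReal_ofReal hpq.nonneg] at this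
    rw [h2] at h1
    have hsc : 0 ≤ s - c := by linarith
    have hκ1 : 0 < κ + 1 := by linarith
    have h4 : 0 ≤ ∫ r in Ioc c s, ‖h r‖ ^ p := integral_nonneg fun r => by positivity
    have hp0 := hpq.pos
    calc ∫ r in Ioc c s, (s - r) ^ (μ - 1) * ‖h r‖
        = ∫ r in Ioc c s, ‖h r‖ * (s - r) ^ (μ - 1) := by simp_rw [mul_comm]
      _ ≤ _ := h1
      _ ≤ A ^ (1 / p) * ((s - c) ^ (κ + 1) / (κ + 1)) ^ (1 / q) := by gcongr
      _ = _ := by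
        rw [div_eq_mul_one_div ((s - c) ^ (κ + 1)), Real.mul_rpow (by positivity) (by positivity),
          ← Real.rpow_mul hsc]
        ring

theorem aestronglyMeasurable_kernel_apply (hRcont : ∀ x, Continuous fun s => R s x)
    {k : ℝ → ℝ} (hk : Measurable k) {m : Measure ℝ} (hh : AEStronglyMeasurable h m) (s : ℝ) :
    AEStronglyMeasurable (fun r => k (s - r) • R (s - r) (h r)) m := by
  refine AEStronglyMeasurable.smul (hk.comp (by fun_prop)).aestronglyMeasurable ?_
  refine aestronglyMeasurable_superposition (F := fun r x => R (s - r) x) (fun x => ?_)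
    (Eventually.of_forall fun r => (R (s - r)).continuous) hh
  exact ((hRcont x).comp (by fun_prop : Continuous fun r : ℝ => s - r)).aestronglyMeasurable

theorem intervalIntegrable_kernel_smul (hμ₀ : 0 < μ) (hμ₁ : μ < 1) (hp : 1 / μ < p)
    (hRC : ∀ s, ‖R s‖ ≤ C) (hRcont : ∀ x, Continuous fun s => R s x)
    (hh : MemLp h (ENNReal.ofReal p) (volume.restrict (Ioc 0 T))) {s : ℝ} (hs : s ∈ Icc 0 T) :
    IntervalIntegrable (fun r => (s - r) ^ (μ - 1) • R (s - r) (h r)) volume 0 s := by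
  obtain ⟨B, γ, -, -, hB⟩ := exists_integral_sub_rpow_mul_le hμ₀ hμ₁ hp hh
  rw [intervalIntegrable_iff_integrableOn_Ioc_of_le hs.1]
  refine Integrable.mono' ((hB 0 s le_rfl hs.1 hs.2).1.const_mul C)
    (aestronglyMeasurable_kernel_apply hRcont (k := fun u => u ^ (μ - 1)) (by fun_prop)
      (hh.1.mono_measure (Measure.restrict_mono (Ioc_subset_Ioc le_rfl hs.2) le_rfl)) s) ?_
  filter_upwards [ae_restrict_mem measurableSet_Ioc] with r hr
  have h1 : 0 ≤ (s - r) ^ (μ - 1) := Real.rpow_nonneg (by linarith [hr.2]) _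
  rw [norm_smul, Real.norm_of_nonneg h1]
  calc _ ≤ (s - r) ^ (μ - 1) * (C * ‖h r‖) := by
        gcongr; exact (R (s - r)).le_of_opNorm_le (hRC _) _
    _ = _ := by ring

/-- A bounded continuous truncation of the kernel `u ^ (μ - 1)` at `u = δ`. -/
def truncKernel (μ δ u : ℝ) : ℝ := max (min (u / δ) 1) 0 * max u δ ^ (μ - 1)

theorem continuous_truncKernel {δ : ℝ} (hδ : 0 < δ) : Continuous (truncKernel μ δ) := by
  unfold truncKernel
  refine Continuous.mul (by fun_prop) ?_
  exact (by fun_prop : Continuous fun u : ℝ => max u δ).rpow_const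
    fun u => Or.inl (lt_max_of_lt_right hδ).ne'

theorem truncKernel_nonneg {δ : ℝ} (hδ : 0 < δ) (u : ℝ) : 0 ≤ truncKernel μ δ u :=
  mul_nonneg (le_max_right _ _) (Real.rpow_nonneg (hδ.le.trans (le_max_right _ _)) _)

theorem truncKernel_le {δ : ℝ} (hμ₁ : μ < 1) (hδ : 0 < δ) (u : ℝ) :
    truncKernel μ δ u ≤ δ ^ (μ - 1) := by
  have h1 : max u δ ^ (μ - 1) ≤ δ ^ (μ - 1) :=
    Real.rpow_le_rpow_of_nonpos hδ (le_max_right _ _) (by linarith)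
  have h2 : 0 ≤ max u δ ^ (μ - 1) := Real.rpow_nonneg (hδ.le.trans (le_max_right _ _)) _
  exact (mul_le_of_le_one_left h2 (max_le (min_le_right _ _) zero_le_one)).trans h1

theorem truncKernel_of_nonpos {δ u : ℝ} (hδ : 0 < δ) (hu : u ≤ 0) : truncKernel μ δ u = 0 := by
  have : u / δ ≤ 0 := div_nonpos_of_nonpos_of_nonneg hu hδ.le
  rw [truncKernel, max_eq_right ((min_le_left _ _).trans this), zero_mul]

theorem truncKernel_of_le {δ u : ℝ} (hδ : 0 < δ) (hu : δ ≤ u) :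
    truncKernel μ δ u = u ^ (μ - 1) := by
  have : 1 ≤ u / δ := (one_le_div hδ).2 hu
  rw [truncKernel, min_eq_right this, max_eq_left zero_le_one, max_eq_left hu, one_mul]

theorem truncKernel_le_rpow {δ u : ℝ} (hμ₁ : μ < 1) (hu : 0 < u) :
    truncKernel μ δ u ≤ u ^ (μ - 1) := by
  have h1 : max u δ ^ (μ - 1) ≤ u ^ (μ - 1) :=
    Real.rpow_le_rpow_of_nonpos hu (le_max_left _ _) (by linarith)
  have h2 : 0 ≤ max u δ ^ (μ - 1) := Real.rpow_nonneg (hu.le.trans (le_max_left _ _)) _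
  exact (mul_le_of_le_one_left h2 (max_le (min_le_right _ _) zero_le_one)).trans h1

theorem continuous_integral_truncKernel (hμ₁ : μ < 1) (hp1 : 1 ≤ p)
    (hRC : ∀ s, ‖R s‖ ≤ C) (hRcont : ∀ x, Continuous fun s => R s x)
    (hh : MemLp h (ENNReal.ofReal p) (volume.restrict (Ioc 0 T))) {δ : ℝ} (hδ : 0 < δ) :
    Continuous fun s => ∫ r in Ioc 0 T, truncKernel μ δ (s - r) • R (s - r) (h r) := by
  have hint : Integrable h (volume.restrict (Ioc 0 T)) :=
    hh.integrable (by simpa using ENNReal.ofReal_le_ofReal hp1)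
  refine continuous_of_dominated (bound := fun r => δ ^ (μ - 1) * (C * ‖h r‖)) (fun s => ?_)
    (fun s => Eventually.of_forall fun r => ?_) ((hint.norm.const_mul C).const_mul _)
    (Eventually.of_forall fun r => ?_)
  · exact aestronglyMeasurable_kernel_apply hRcont (continuous_truncKernel hδ).measurable hh.1 s
  · rw [norm_smul, Real.norm_of_nonneg (truncKernel_nonneg hδ _)]
    exact mul_le_mul (truncKernel_le hμ₁ hδ _) ((R (s - r)).le_of_opNorm_le (hRC _) _)
      (norm_nonneg _) (Real.rpow_nonneg hδ.le _)
  · exact ((continuous_truncKernel hδ).comp (by fun_prop : Continuous fun s : ℝ => s - r)).smul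
      ((hRcont (h r)).comp (by fun_prop : Continuous fun s : ℝ => s - r))

/-- The mild-solution convolution of an `L^p` function, `p > 1 / μ`, is continuous. -/
theorem continuousOn_integral_kernel_smul (hμ₀ : 0 < μ) (hμ₁ : μ < 1) (hp : 1 / μ < p)
    (hC : 0 ≤ C) (hRC : ∀ s, ‖R s‖ ≤ C) (hRcont : ∀ x, Continuous fun s => R s x)
    (hh : MemLp h (ENNReal.ofReal p) (volume.restrict (Ioc 0 T))) :
    ContinuousOn (fun s => ∫ r in (0 : ℝ)..s, (s - r) ^ (μ - 1) • R (s - r) (h r)) (Icc 0 T) := by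
  have hp1 : 1 ≤ p := (((one_lt_div hμ₀).2 hμ₁).trans hp).le
  obtain ⟨B, γ, hB0, hγ, hB⟩ := exists_integral_sub_rpow_mul_le hμ₀ hμ₁ hp hh
  -- The truncated kernel vanishes for `r ≥ s` and is exact for `r ≤ s - δ`, so the error lives on
  -- the last stretch of length `δ`, where Hölder gives `B δ ^ γ` uniformly in `s`. Continuity then
  -- passes through the uniform limit.
  have happrox : ∀ δ : ℝ, 0 < δ → ∀ s ∈ Icc 0 T,
      dist (∫ r in (0 : ℝ)..s, (s - r) ^ (μ - 1) • R (s - r) (h r))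
        (∫ r in Ioc 0 T, truncKernel μ δ (s - r) • R (s - r) (h r)) ≤ C * (B * δ ^ γ) := by
    intro δ hδ s hs
    have hss : Ioc 0 s ⊆ Ioc 0 T := Ioc_subset_Ioc le_rfl hs.2
    have h1 : ∫ r in Ioc 0 T, truncKernel μ δ (s - r) • R (s - r) (h r) =
        ∫ r in Ioc 0 s, truncKernel μ δ (s - r) • R (s - r) (h r) := by
      refine setIntegral_eq_of_subset_of_forall_sdiff_eq_zero measurableSet_Ioc hss
        fun r hr => ?_
      have : s < r := by
        by_contra hle
        exact hr.2 ⟨hr.1.1, not_lt.1 hle⟩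
      rw [truncKernel_of_nonpos hδ (by linarith), zero_smul]
    set c := max 0 (s - δ) with hc
    have hcs : c ≤ s := max_le hs.1 (by linarith)
    have hi1 := intervalIntegrable_kernel_smul hμ₀ hμ₁ hp hRC hRcont hh hs
    rw [intervalIntegrable_iff_integrableOn_Ioc_of_le hs.1] at hi1
    have hm := hh.1.mono_measure (Measure.restrict_mono hss (le_refl (volume : Measure ℝ)))
    have htr : ∀ r ∈ Ioc 0 s, ‖truncKernel μ δ (s - r) • R (s - r) (h r)‖ ≤
        C * ((s - r) ^ (μ - 1) * ‖h r‖) := by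
      intro r hr
      rw [norm_smul, Real.norm_of_nonneg (truncKernel_nonneg hδ _)]
      have h2 : truncKernel μ δ (s - r) ≤ (s - r) ^ (μ - 1) := by
        rcases hr.2.eq_or_lt with h | h
        · rw [truncKernel_of_nonpos hδ (by linarith)]
          exact Real.rpow_nonneg (by linarith) _
        · exact truncKernel_le_rpow hμ₁ (by linarith)
      calc _ ≤ (s - r) ^ (μ - 1) * (C * ‖h r‖) :=
            mul_le_mul h2 ((R (s - r)).le_of_opNorm_le (hRC _) _) (norm_nonneg _)
              (Real.rpow_nonneg (by linarith [hr.2]) _)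
        _ = _ := by ring
    have hi2 : IntegrableOn (fun r => truncKernel μ δ (s - r) • R (s - r) (h r)) (Ioc 0 s) := by
      refine Integrable.mono' ((hB 0 s le_rfl hs.1 hs.2).1.const_mul C)
        (aestronglyMeasurable_kernel_apply hRcont (continuous_truncKernel hδ).measurable hm s) ?_
      filter_upwards [ae_restrict_mem measurableSet_Ioc] with r hr using htr r hr
    rw [h1, intervalIntegral.integral_of_le hs.1, dist_eq_norm, ← integral_sub hi1 hi2]
    have hsub : Ioc c s ⊆ Ioc 0 s := Ioc_subset_Ioc (le_max_left _ _) le_rfl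
    rw [setIntegral_eq_of_subset_of_forall_sdiff_eq_zero measurableSet_Ioc hsub fun r hr => ?_]
    · obtain ⟨hBi, hBle⟩ := hB c s (le_max_left _ _) hcs hs.2
      refine (norm_integral_le_of_norm_le (hBi.const_mul C) ?_).trans ?_
      · filter_upwards [ae_restrict_mem measurableSet_Ioc] with r hr
        have hr0 : r ∈ Ioc 0 s := hsub hr
        have h3 : 0 ≤ (s - r) ^ (μ - 1) := Real.rpow_nonneg (by linarith [hr.2]) _
        have h4 : 0 ≤ (s - r) ^ (μ - 1) - truncKernel μ δ (s - r) := by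
          rcases hr.2.eq_or_lt with h | h
          · rw [truncKernel_of_nonpos hδ (by linarith), sub_zero]; exact h3
          · linarith [truncKernel_le_rpow (δ := δ) hμ₁ (show 0 < s - r by linarith)]
        rw [← sub_smul, norm_smul, Real.norm_of_nonneg h4]
        calc _ ≤ (s - r) ^ (μ - 1) * (C * ‖h r‖) :=
              mul_le_mul (by linarith [truncKernel_nonneg (μ := μ) hδ (s - r)])
                ((R (s - r)).le_of_opNorm_le (hRC _) _) (norm_nonneg _) h3
          _ = _ := by ring
      · rw [integral_const_mul]
        refine mul_le_mul_of_nonneg_left (hBle.trans ?_) hC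
        refine mul_le_mul_of_nonneg_left ?_ hB0
        refine Real.rpow_le_rpow (by linarith) ?_ hγ.le
        linarith [le_max_right 0 (s - δ)]
    · have h5 : r ≤ s - δ := by
        by_contra hlt
        exact hr.2 ⟨max_lt hr.1.1 (not_le.1 hlt), hr.1.2⟩
      rw [truncKernel_of_le hδ (by linarith), sub_self]
  refine continuousOn_of_uniform_approx_of_continuousOn fun u hu => ?_
  obtain ⟨ε, hε, hεu⟩ := Metric.mem_uniformity_dist.1 hu
  have htend : Tendsto (fun δ : ℝ => C * (B * δ ^ γ)) (𝓝[>] 0) (𝓝 (C * (B * 0 ^ γ))) := by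
    refine Tendsto.mono_left ?_ nhdsWithin_le_nhds
    exact (((Real.continuousAt_rpow_const 0 γ (Or.inr hγ.le)).tendsto).const_mul B).const_mul C
  rw [Real.zero_rpow hγ.ne', mul_zero, mul_zero] at htend
  obtain ⟨δ, hδε, hδ⟩ := ((htend.eventually (gt_mem_nhds hε)).and self_mem_nhdsWithin).exists
  exact ⟨_, (continuous_integral_truncKernel hμ₁ hp1 hRC hRcont hh hδ).continuousOn,
    fun s hs => hεu ((happrox δ hδ s hs).trans_lt hδε)⟩

/-- Enlarging the range to `(0, ∞)` gives a Gamma integral. The factor `ω ^ (-μ)` is the source of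
the contraction. -/
theorem integral_sub_rpow_mul_exp_le (hμ₀ : 0 < μ) {ω s : ℝ} (hω : 0 < ω) (hs : 0 ≤ s) :
    IntervalIntegrable (fun r => (s - r) ^ (μ - 1) * Real.exp (-(ω * (s - r)))) volume 0 s ∧
      ∫ r in (0 : ℝ)..s, (s - r) ^ (μ - 1) * Real.exp (-(ω * (s - r))) ≤
        (1 / ω) ^ μ * Real.Gamma μ := by
  have hint := integrableOn_rpow_mul_exp_neg_mul hμ₀ hω
  constructor
  · have h1 : IntervalIntegrable (fun u : ℝ => u ^ (μ - 1) * Real.exp (-(ω * u))) volume s 0 :=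
      ((intervalIntegrable_iff_integrableOn_Ioc_of_le hs).2
        (hint.mono_set Ioc_subset_Ioi_self)).symm
    simpa using h1.comp_sub_left s
  · rw [intervalIntegral.integral_comp_sub_left
      (fun u : ℝ => u ^ (μ - 1) * Real.exp (-(ω * u))) s, sub_self, sub_zero,
      intervalIntegral.integral_of_le hs, ← Real.integral_rpow_mul_exp_neg_mul_Ioi hμ₀ hω]
    refine setIntegral_mono_set hint ?_ (LE.le.eventuallyLE Ioc_subset_Ioi_self)
    filter_upwards [ae_restrict_mem measurableSet_Ioi] with u hu
    have : 0 ≤ u ^ (μ - 1) := Real.rpow_nonneg (le_of_lt hu) _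
    exact mul_nonneg this (Real.exp_pos _).le

end Convolution

/-! ### Weighted function spaces on one interval -/

section Weighted

variable {E : Type*} [NormedAddCommGroup E] [NormedSpace ℝ E] {l a b : ℝ}

/-- `(s - a) ^ (1 - l) x(s)` is continuous and bounded on `(a, b]`. -/
def WeightedBdd (l a b : ℝ) (x : ℝ → E) : Prop :=
  ContinuousOn (fun s => (s - a) ^ (1 - l) • x s) (Ioc a b) ∧
    BddAbove ((fun s => (s - a) ^ (1 - l) * ‖x s‖) '' Ioc a b)

theorem WeightedBdd.exists_bound {x : ℝ → E} (hx : WeightedBdd l a b x) :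
    ∃ D, 0 ≤ D ∧ ∀ s ∈ Ioc a b, (s - a) ^ (1 - l) * ‖x s‖ ≤ D := by
  obtain ⟨D, hD⟩ := hx.2
  exact ⟨max D 0, le_max_right _ _,
    fun s hs => (hD (mem_image_of_mem _ hs)).trans (le_max_left _ _)⟩

theorem weightedBdd_of_bound {x : ℝ → E} {D : ℝ}
    (hc : ContinuousOn (fun s => (s - a) ^ (1 - l) • x s) (Ioc a b))
    (hD : ∀ s ∈ Ioc a b, (s - a) ^ (1 - l) * ‖x s‖ ≤ D) : WeightedBdd l a b x :=
  ⟨hc, D, by rintro _ ⟨s, hs, rfl⟩; exact hD s hs⟩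

theorem WeightedBdd.congr {x y : ℝ → E} (hx : WeightedBdd l a b x) (h : EqOn y x (Ioc a b)) :
    WeightedBdd l a b y := by
  obtain ⟨D, -, hD⟩ := hx.exists_bound
  refine weightedBdd_of_bound (D := D) (hx.1.congr fun s hs => ?_) fun s hs => ?_
  · simp only [h hs]
  · rw [h hs]; exact hD s hs

theorem WeightedBdd.add {x y : ℝ → E} (hx : WeightedBdd l a b x) (hy : WeightedBdd l a b y) :
    WeightedBdd l a b fun s => x s + y s := by
  obtain ⟨D, -, hD⟩ := hx.exists_bound
  obtain ⟨D', -, hD'⟩ := hy.exists_bound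
  refine weightedBdd_of_bound (D := D + D') ?_ fun s hs => ?_
  · simp only [smul_add]
    exact hx.1.add hy.1
  · have h1 : 0 ≤ (s - a) ^ (1 - l) := Real.rpow_nonneg (by linarith [hs.1]) _
    calc _ ≤ (s - a) ^ (1 - l) * (‖x s‖ + ‖y s‖) := by gcongr; exact norm_add_le _ _
      _ = (s - a) ^ (1 - l) * ‖x s‖ + (s - a) ^ (1 - l) * ‖y s‖ := by ring
      _ ≤ _ := add_le_add (hD s hs) (hD' s hs)

theorem weightedBdd_sum {ι : Type*} (u : Finset ι) {x : ι → ℝ → E}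
    (hx : ∀ i ∈ u, WeightedBdd l a b (x i)) : WeightedBdd l a b fun s => ∑ i ∈ u, x i s := by
  classical
  induction u using Finset.induction_on with
  | empty => exact weightedBdd_of_bound (D := 0) (by simpa using continuousOn_const) (by simp)
  | insert i u hi ih =>
    simp only [Finset.sum_insert hi]
    exact (hx i (Finset.mem_insert_self i u)).add
      (ih fun j hj => hx j (Finset.mem_insert_of_mem hj))

theorem continuousOn_sub_rpow (κ : ℝ) : ContinuousOn (fun s : ℝ => (s - a) ^ κ) (Ioc a b) :=
  ContinuousOn.rpow_const (by fun_prop) fun s hs => Or.inl (by linarith [hs.1])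

theorem WeightedBdd.continuousOn {x : ℝ → E} (hx : WeightedBdd l a b x) :
    ContinuousOn x (Ioc a b) := by
  refine ((continuousOn_sub_rpow (l - 1)).smul hx.1).congr fun s hs => ?_
  have h1 : 0 < s - a := by linarith [hs.1]
  change x s = (s - a) ^ (l - 1) • ((s - a) ^ (1 - l) • x s)
  rw [smul_smul, ← Real.rpow_add h1]
  simp

theorem weightedBdd_of_continuousOn (hl : l ≤ 1) {x : ℝ → E} (hx : ContinuousOn x (Icc a b)) :
    WeightedBdd l a b x := by
  obtain ⟨D, hD⟩ := isCompact_Icc.exists_bound_of_continuousOn hx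
  refine weightedBdd_of_bound (D := (b - a) ^ (1 - l) * D)
    ((continuousOn_sub_rpow _).smul (hx.mono Ioc_subset_Icc_self)) fun s hs => ?_
  have h1 : 0 ≤ s - a := by linarith [hs.1]
  have h2 : s - a ≤ b - a := by linarith [hs.2]
  exact mul_le_mul (Real.rpow_le_rpow h1 h2 (by linarith)) (hD s (Ioc_subset_Icc_self hs))
    (norm_nonneg _) (Real.rpow_nonneg (h1.trans h2) _)

/-- A singularity at `c ≤ a` is no worse than one at `a`, because `(s - a) ^ (1 - l) ≤ (s - c) ^ (1
- l)`. Hence the initial term and all earlier impulses are admissible forcing on later intervals. -/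
theorem weightedBdd_rpow_smul (hl : l ≤ 1) {c D : ℝ} (hca : c ≤ a) {W : ℝ → E}
    (hW : Continuous W) (hD : ∀ s, ‖W s‖ ≤ D) :
    WeightedBdd l a b fun s => (s - c) ^ (l - 1) • W (s - c) := by
  refine weightedBdd_of_bound (D := D) ((continuousOn_sub_rpow _).smul (ContinuousOn.smul
    (ContinuousOn.rpow_const (by fun_prop) fun s hs => Or.inl (by linarith [hs.1]))
    (hW.comp (by fun_prop : Continuous fun s : ℝ => s - c)).continuousOn)) fun s hs => ?_
  have h1 : 0 < s - a := by linarith [hs.1]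
  have h2 : 0 < s - c := by linarith
  have h3 : (s - a) ^ (1 - l) ≤ (s - c) ^ (1 - l) :=
    Real.rpow_le_rpow h1.le (by linarith) (by linarith)
  have h4 : 0 ≤ (s - c) ^ (l - 1) := Real.rpow_nonneg h2.le _
  rw [norm_smul, Real.norm_of_nonneg h4]
  calc _ ≤ (s - c) ^ (1 - l) * ((s - c) ^ (l - 1) * ‖W (s - c)‖) := by gcongr
    _ = ‖W (s - c)‖ := by
      rw [← mul_assoc, ← Real.rpow_add h2]; simp
    _ ≤ D := hD _

/-- The element `s ↦ exp (-ω s) (s - a) ^ (1 - l) x(s)` of the space of bounded continuous functions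
on `(a, b]`. -/
def WeightedBdd.toBCF {x : ℝ → E} (hx : WeightedBdd l a b x) (ω : ℝ) (hω : 0 ≤ ω) (ha : 0 ≤ a) :
    BoundedContinuousFunction (Ioc a b) E :=
  BoundedContinuousFunction.ofNormedAddCommGroup
    (fun s => (Real.exp (-(ω * s)) * ((s : ℝ) - a) ^ (1 - l)) • x s)
    (by
      have h : ContinuousOn (fun s => Real.exp (-(ω * s)) • ((s - a) ^ (1 - l) • x s))
        (Ioc a b) := ContinuousOn.smul (by fun_prop) hx.1
      simpa only [smul_smul] using! continuousOn_iff_continuous_domRestrict.1 h)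
    hx.exists_bound.choose
    (fun s => by
      have h1 : 0 ≤ ((s : ℝ) - a) ^ (1 - l) := Real.rpow_nonneg (by linarith [s.2.1]) _
      have h2 : 0 ≤ ω * s := mul_nonneg hω (by linarith [s.2.1])
      rw [norm_smul, norm_mul, Real.norm_of_nonneg h1, Real.norm_of_nonneg (Real.exp_pos _).le,
        mul_assoc]
      refine (mul_le_of_le_one_left (by positivity) (Real.exp_le_one_iff.2 (by linarith))).trans ?_
      exact hx.exists_bound.choose_spec.2 s s.2)

/-- The function equal to `y` off `(a, b]` and to `exp (ω s) (s - a) ^ (l - 1) z(s)` on it. -/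
def unweight (l a b ω : ℝ) (y : ℝ → E) (z : BoundedContinuousFunction (Ioc a b) E) (s : ℝ) : E :=
  open Classical in
  if h : s ∈ Ioc a b then (Real.exp (ω * s) * (s - a) ^ (l - 1)) • z ⟨s, h⟩ else y s

theorem unweight_of_mem {ω : ℝ} {y : ℝ → E} {z : BoundedContinuousFunction (Ioc a b) E} {s : ℝ}
    (h : s ∈ Ioc a b) :
    unweight l a b ω y z s = (Real.exp (ω * s) * (s - a) ^ (l - 1)) • z ⟨s, h⟩ :=
  dif_pos h

theorem unweight_of_le {ω : ℝ} {y : ℝ → E} {z : BoundedContinuousFunction (Ioc a b) E} {s : ℝ}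
    (h : s ≤ a) : unweight l a b ω y z s = y s :=
  dif_neg fun h' => not_lt.2 h h'.1

theorem weight_smul_unweight {ω : ℝ} {y : ℝ → E} {z : BoundedContinuousFunction (Ioc a b) E}
    {s : ℝ} (h : s ∈ Ioc a b) :
    (s - a) ^ (1 - l) • unweight l a b ω y z s = Real.exp (ω * s) • z ⟨s, h⟩ := by
  have h1 : 0 < s - a := by linarith [h.1]
  have h2 : (s - a) ^ (1 - l) * (s - a) ^ (l - 1) = 1 := by
    rw [← Real.rpow_add h1]; simp
  rw [unweight_of_mem h, smul_smul, mul_left_comm, h2, mul_one]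

theorem weightedBdd_unweight {ω : ℝ} (y : ℝ → E) (z : BoundedContinuousFunction (Ioc a b) E)
    (hω : 0 ≤ ω) : WeightedBdd l a b (unweight l a b ω y z) := by
  refine weightedBdd_of_bound (D := Real.exp (ω * b) * ‖z‖) ?_ fun s hs => ?_
  · rw [continuousOn_iff_continuous_domRestrict]
    have : (Ioc a b).domRestrict (fun s => (s - a) ^ (1 - l) • unweight l a b ω y z s) =
        fun s : Ioc a b => Real.exp (ω * s) • z s := by
      funext s
      exact weight_smul_unweight s.2
    rw [this]
    exact Continuous.smul (by fun_prop) z.continuous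
  · have h1 : 0 ≤ (s - a) ^ (1 - l) := Real.rpow_nonneg (by linarith [hs.1]) _
    rw [← Real.norm_of_nonneg h1, ← norm_smul, weight_smul_unweight hs, norm_smul,
      Real.norm_of_nonneg (Real.exp_pos _).le]
    have := hs.2
    gcongr
    exact z.norm_coe_le_norm _

theorem toBCF_apply {x : ℝ → E} (hx : WeightedBdd l a b x) {ω : ℝ} (hω : 0 ≤ ω) (ha : 0 ≤ a)
    (s : Ioc a b) : hx.toBCF ω hω ha s = (Real.exp (-(ω * s)) * ((s : ℝ) - a) ^ (1 - l)) • x s :=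
  rfl

theorem unweight_toBCF {x y : ℝ → E} (hx : WeightedBdd l a b x) {ω : ℝ} (hω : 0 ≤ ω) (ha : 0 ≤ a)
    {s : ℝ} (hs : s ∈ Ioc a b) : unweight l a b ω y (hx.toBCF ω hω ha) s = x s := by
  have h1 : 0 < s - a := by linarith [hs.1]
  have h2 : (s - a) ^ (l - 1) * (s - a) ^ (1 - l) = 1 := by
    rw [← Real.rpow_add h1]; simp
  have h3 : Real.exp (ω * s) * Real.exp (-(ω * s)) = 1 := by rw [← Real.exp_add]; simp
  rw [unweight_of_mem hs, toBCF_apply, smul_smul, mul_mul_mul_comm, h2, h3, one_mul, one_smul]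

end Weighted

/-! ### Solving the Volterra equation on one interval -/

section Step

variable {E : Type*} [NormedAddCommGroup E] [NormedSpace ℝ E] {μ l p T a b β L C : ℝ}
  {R : ℝ → E →L[ℝ] E} {F : ℝ → E → E} {α : ℝ → ℝ}

/-- The right-hand side `f(s) + ∫₀^s (s - r) ^ (μ - 1) R(s - r) F(r, x(r)) dr`. -/
def volterraRhs (μ : ℝ) (R : ℝ → E →L[ℝ] E) (F : ℝ → E → E) (f x : ℝ → E) (s : ℝ) : E :=
  f s + ∫ r in (0 : ℝ)..s, (s - r) ^ (μ - 1) • R (s - r) (F r (x r))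

/-- The weight in the growth bound is the one that controls `x`, so their product is bounded and
only `α` limits integrability. -/
theorem memLp_superposition (ha : 0 ≤ a) (hbT : b ≤ T)
    (hFm : ∀ x, AEStronglyMeasurable (fun s => F s x) (volume.restrict (Icc 0 T)))
    (hFc : ∀ᵐ s ∂(volume.restrict (Icc 0 T)), Continuous (F s))
    (hα : MemLp α (ENNReal.ofReal p) (volume.restrict (Icc 0 T)))
    (hgrowth : ∀ᵐ s ∂(volume.restrict (Icc 0 T)), s ∈ Ioc a b →
      ∀ x, ‖F s x‖ ≤ α s + β * (s - a) ^ (1 - l) * ‖x‖) (hβ : 0 ≤ β)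
    {x : ℝ → E} (hx : WeightedBdd l a b x) :
    MemLp (fun r => F r (x r)) (ENNReal.ofReal p) (volume.restrict (Ioc a b)) := by
  obtain ⟨D, hD0, hD⟩ := hx.exists_bound
  have hsub : Ioc a b ⊆ Icc 0 T := fun s hs => ⟨ha.trans hs.1.le, hs.2.trans hbT⟩
  have hle : volume.restrict (Ioc a b) ≤ volume.restrict (Icc 0 T) :=
    Measure.restrict_mono hsub le_rfl
  refine MemLp.mono' (g := fun r => α r + β * D) ((hα.mono_measure hle).add (memLp_const _)) ?_ ?_
  · exact aestronglyMeasurable_superposition (fun x => (hFm x).mono_measure hle)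
      (ae_mono hle hFc) (hx.continuousOn.aestronglyMeasurable measurableSet_Ioc)
  · filter_upwards [ae_mono hle hgrowth, ae_restrict_mem measurableSet_Ioc] with r hr hrm
    refine (hr hrm _).trans ?_
    rw [mul_assoc]
    have := hD r hrm
    gcongr

theorem memLp_Ioc_union {E : Type*} [NormedAddCommGroup E] {h : ℝ → E} {q : ENNReal} (ha : 0 ≤ a) (hab : a ≤ b)
    (h1 : MemLp h q (volume.restrict (Ioc 0 a))) (h2 : MemLp h q (volume.restrict (Ioc a b))) :
    MemLp h q (volume.restrict (Ioc 0 b)) := by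
  classical
  have h3 := MemLp.piecewise (μ := volume.restrict (Ioc 0 b)) (s := Iic a) (f := h) (g := h)
    (p := q) measurableSet_Iic
    (by
      rw [Measure.restrict_restrict measurableSet_Iic]
      convert! h1 using 2
      ext s
      simp only [mem_inter_iff, mem_Iic, mem_Ioc]
      exact ⟨fun h => ⟨h.2.1, h.1⟩, fun h => ⟨h.2, h.1, h.2.trans hab⟩⟩)
    (by
      rw [Measure.restrict_restrict measurableSet_Iic.compl]
      convert! h2 using 2
      ext s
      simp only [mem_inter_iff, compl_Iic, mem_Ioi, mem_Ioc]
      exact ⟨fun h => ⟨h.1, h.2.2⟩, fun h => ⟨h.1, ha.trans_lt h.1, h.2⟩⟩)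
  simpa using h3

/-- Unique solvability of the weakly singular Volterra equation on `(a, b]`, the solution being
prescribed on `(0, a]`. -/
theorem existsUnique_volterra [CompleteSpace E] (hμ₀ : 0 < μ) (hμ₁ : μ < 1) (hp : 1 / μ < p)
    (hl : l ≤ 1) (ha : 0 ≤ a) (hab : a < b) (hbT : b ≤ T)
    (hC : 0 ≤ C) (hRC : ∀ s, ‖R s‖ ≤ C) (hRcont : ∀ x, Continuous fun s => R s x)
    (hFm : ∀ x, AEStronglyMeasurable (fun s => F s x) (volume.restrict (Icc 0 T)))
    (hFc : ∀ᵐ s ∂(volume.restrict (Icc 0 T)), Continuous (F s))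
    (hα : MemLp α (ENNReal.ofReal p) (volume.restrict (Icc 0 T)))
    (hgrowth : ∀ᵐ s ∂(volume.restrict (Icc 0 T)), s ∈ Ioc a b →
      ∀ x, ‖F s x‖ ≤ α s + β * (s - a) ^ (1 - l) * ‖x‖) (hβ : 0 ≤ β)
    (hlip : ∀ᵐ s ∂(volume.restrict (Icc 0 T)), s ∈ Ioc a b →
      ∀ x y, ‖F s x - F s y‖ ≤ L * (s - a) ^ (1 - l) * ‖x - y‖) (hL : 0 ≤ L)
    {f y : ℝ → E} (hf : WeightedBdd l a b f)
    (hy : MemLp (fun r => F r (y r)) (ENNReal.ofReal p) (volume.restrict (Ioc 0 a))) :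
    ∃ x : ℝ → E, EqOn x y (Iic a) ∧ WeightedBdd l a b x ∧
      EqOn x (volterraRhs μ R F f x) (Ioc a b) ∧
      ∀ x' : ℝ → E, EqOn x' y (Ioc 0 a) → WeightedBdd l a b x' →
        EqOn x' (volterraRhs μ R F f x') (Ioc a b) → EqOn x' x (Ioc a b) := by
  have hmem : ∀ x : ℝ → E, EqOn x y (Ioc 0 a) → WeightedBdd l a b x →
      MemLp (fun r => F r (x r)) (ENNReal.ofReal p) (volume.restrict (Ioc 0 b)) := by
    intro x hxy hx
    refine memLp_Ioc_union ha hab.le (hy.ae_eq ?_)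
      (memLp_superposition ha hbT hFm hFc hα hgrowth hβ hx)
    filter_upwards [ae_restrict_mem measurableSet_Ioc] with r hr
    rw [hxy hr]
  have hrhs : ∀ x : ℝ → E, EqOn x y (Ioc 0 a) → WeightedBdd l a b x →
      WeightedBdd l a b (volterraRhs μ R F f x) := by
    intro x hxy hx
    refine hf.add (weightedBdd_of_continuousOn hl ?_)
    exact (continuousOn_integral_kernel_smul hμ₀ hμ₁ hp hC hRC hRcont (hmem x hxy hx)).mono
      (Icc_subset_Icc ha le_rfl)
  set K₀ : ℝ := (b - a) ^ (1 - l) * (C * L) * Real.Gamma μ with hK₀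
  have hK₀0 : 0 ≤ K₀ := by
    have h1 : 0 ≤ (b - a) ^ (1 - l) := Real.rpow_nonneg (by linarith) _
    have h2 := Real.Gamma_pos_of_pos hμ₀
    positivity
  -- Chosen so that `K₀ ω ^ (-μ) ≤ 1/2`, where `K₀` collects the constants of the contraction
  -- estimate; the `+ 1` keeps `ω` positive even if `K₀ = 0`.
  set ω : ℝ := (2 * (K₀ + 1)) ^ (1 / μ) with hωdef
  have hω : 0 < ω := Real.rpow_pos_of_pos (by positivity) _
  have hωK : K₀ * (1 / ω) ^ μ ≤ 1 / 2 := by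
    have : ω ^ μ = 2 * (K₀ + 1) := by
      rw [hωdef, ← Real.rpow_mul (by positivity), one_div_mul_cancel hμ₀.ne', Real.rpow_one]
    rw [Real.div_rpow zero_le_one hω.le, Real.one_rpow, this, mul_one_div, div_le_iff₀ (by positivity)]
    linarith
  set X := BoundedContinuousFunction (Ioc a b) E
  let u : X → ℝ → E := fun z => unweight l a b ω y z
  have huy : ∀ z, EqOn (u z) y (Iic a) := fun z s hs => unweight_of_le hs
  have huy' : ∀ z, EqOn (u z) y (Ioc 0 a) := fun z s hs => huy z hs.2
  have hub : ∀ z, WeightedBdd l a b (u z) := fun z => weightedBdd_unweight y z hω.le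
  -- The solution map transported to bounded continuous functions on `(a, b]`, a complete space; the
  -- past `y` is built into `u z`.
  let Φ : X → X := fun z => (hrhs (u z) (huy' z) (hub z)).toBCF ω hω.le ha
  have hcontr : ContractingWith (1 / 2) Φ := by
    refine ⟨by rw [← NNReal.coe_lt_coe]; norm_num, LipschitzWith.of_dist_le_mul fun z₁ z₂ => ?_⟩
    set d := dist z₁ z₂
    have hd : 0 ≤ d := dist_nonneg
    have hgoal0 : (0 : ℝ) ≤ ((1 / 2 : NNReal) : ℝ) * d := mul_nonneg (NNReal.coe_nonneg _) hd
    rw [BoundedContinuousFunction.dist_le hgoal0]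
    rintro ⟨s, hs⟩
    have hs0 : 0 ≤ s := ha.trans hs.1.le
    have hsT : s ∈ Icc 0 b := ⟨hs0, hs.2⟩
    have hw0 : 0 ≤ (s - a) ^ (1 - l) := Real.rpow_nonneg (by linarith [hs.1]) _
    have hi := fun z => intervalIntegrable_kernel_smul hμ₀ hμ₁ hp hRC hRcont
      (hmem (u z) (huy' z) (hub z)) hsT
    obtain ⟨hki, hkle⟩ := integral_sub_rpow_mul_exp_le hμ₀ hω hs0
    have hdiff : ‖volterraRhs μ R F f (u z₁) s - volterraRhs μ R F f (u z₂) s‖ ≤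
        Real.exp (ω * s) * (C * L * d) * ((1 / ω) ^ μ * Real.Gamma μ) := by
      rw [volterraRhs, volterraRhs, add_sub_add_left_eq_sub, ← intervalIntegral.integral_sub (hi z₁)
        (hi z₂)]
      refine le_trans ?_ (mul_le_mul_of_nonneg_left hkle (by positivity))
      rw [← intervalIntegral.integral_const_mul]
      refine intervalIntegral.norm_integral_le_of_norm_le hs0 ?_ (hki.const_mul _)
      have hsub : Ioc 0 s ⊆ Icc 0 T := fun r hr => ⟨hr.1.le, hr.2.trans (hs.2.trans hbT)⟩
      rw [← ae_restrict_iff' measurableSet_Ioc]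
      filter_upwards [ae_restrict_of_ae_restrict_of_subset hsub hlip,
        ae_restrict_mem measurableSet_Ioc] with r hrl hr
      have hk0 : 0 ≤ (s - r) ^ (μ - 1) := Real.rpow_nonneg (by linarith [hr.2]) _
      -- Up to `a` the two candidates share the same past. Beyond it, the Lipschitz weight `(r - a)
      -- ^ (1 - l)` cancels the singular factor of `unweight`.
      have hF : ‖F r (u z₁ r) - F r (u z₂ r)‖ ≤ L * (Real.exp (ω * r) * d) := by
        rcases le_or_gt r a with hra | hra
        · rw [huy z₁ hra, huy z₂ hra, sub_self, norm_zero]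
          positivity
        · have hrm : r ∈ Ioc a b := ⟨hra, hr.2.trans hs.2⟩
          refine (hrl hrm _ _).trans ?_
          rw [mul_assoc]
          refine mul_le_mul_of_nonneg_left ?_ hL
          have h1 : 0 ≤ (r - a) ^ (1 - l) := Real.rpow_nonneg (by linarith) _
          rw [← Real.norm_of_nonneg h1, ← norm_smul, smul_sub, weight_smul_unweight hrm,
            weight_smul_unweight hrm, ← smul_sub, norm_smul,
            Real.norm_of_nonneg (Real.exp_pos _).le, ← dist_eq_norm]
          exact mul_le_mul_of_nonneg_left (BoundedContinuousFunction.dist_coe_le_dist _)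
            (Real.exp_pos _).le
      rw [← smul_sub, ← map_sub, norm_smul, Real.norm_of_nonneg hk0]
      calc (s - r) ^ (μ - 1) * ‖R (s - r) (F r (u z₁ r) - F r (u z₂ r))‖
          ≤ (s - r) ^ (μ - 1) * (C * (L * (Real.exp (ω * r) * d))) := by
            gcongr
            exact ((R (s - r)).le_of_opNorm_le (hRC _) _).trans (by gcongr)
        _ = Real.exp (ω * s) * (C * L * d) *
            ((s - r) ^ (μ - 1) * Real.exp (-(ω * (s - r)))) := by
            have : Real.exp (ω * r) = Real.exp (ω * s) * Real.exp (-(ω * (s - r))) := by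
              rw [← Real.exp_add]; congr 1; ring
            rw [this]
            ring
    have hexp : Real.exp (-(ω * s)) * Real.exp (ω * s) = 1 := by rw [← Real.exp_add]; simp
    have hwb : (s - a) ^ (1 - l) ≤ (b - a) ^ (1 - l) :=
      Real.rpow_le_rpow (by linarith [hs.1]) (by linarith [hs.2]) (by linarith)
    have hΓ := Real.Gamma_pos_of_pos hμ₀
    have hωμ : 0 ≤ (1 / ω) ^ μ := Real.rpow_nonneg (by positivity) _
    rw [toBCF_apply, toBCF_apply, dist_eq_norm, ← smul_sub, norm_smul,
      Real.norm_of_nonneg (mul_nonneg (Real.exp_pos _).le hw0)]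
    calc Real.exp (-(ω * s)) * (s - a) ^ (1 - l) *
          ‖volterraRhs μ R F f (u z₁) s - volterraRhs μ R F f (u z₂) s‖
        ≤ Real.exp (-(ω * s)) * (b - a) ^ (1 - l) *
          (Real.exp (ω * s) * (C * L * d) * ((1 / ω) ^ μ * Real.Gamma μ)) := by gcongr
      _ = (Real.exp (-(ω * s)) * Real.exp (ω * s)) * (K₀ * (1 / ω) ^ μ * d) := by
          rw [hK₀]; ring
      _ = K₀ * (1 / ω) ^ μ * d := by rw [hexp, one_mul]
      _ ≤ 1 / 2 * d := by gcongr
      _ = _ := by norm_num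
  have : Nonempty X := ⟨0⟩
  set z := ContractingWith.fixedPoint Φ hcontr with hz
  have hfix : Φ z = z := hcontr.fixedPoint_isFixedPt
  refine ⟨u z, huy z, hub z, fun s hs => ?_, fun x' hx'y hx' hx'eq s hs => ?_⟩
  · have h1 := unweight_toBCF (y := y) (hrhs (u z) (huy' z) (hub z)) hω.le ha hs
    rw [← h1]
    change _ = unweight l a b ω y (Φ z) s
    rw [hfix]
  -- Any other solution, once weighted, is a fixed point of the same map. Only its values on `(0,
  -- b]` matter, so disagreement with `y` at nonpositive times is harmless.
  · have hux' : EqOn (u (hx'.toBCF ω hω.le ha)) x' (Ioc 0 b) := by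
      intro r hr
      rcases le_or_gt r a with hra | hra
      · rw [huy _ hra, hx'y ⟨hr.1, hra⟩]
      · exact unweight_toBCF hx' hω.le ha ⟨hra, hr.2⟩
    have hfix' : Function.IsFixedPt Φ (hx'.toBCF ω hω.le ha) := by
      ext s
      change (hrhs _ (huy' _) (hub _)).toBCF ω hω.le ha s = _
      rw [toBCF_apply, toBCF_apply, hx'eq s.2]
      congr 1
      rw [volterraRhs, volterraRhs]
      congr 1
      refine intervalIntegral.integral_congr_ae (Eventually.of_forall fun r hr => ?_)
      rw [uIoc_of_le (ha.trans s.2.1.le)] at hr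
      rw [hux' ⟨hr.1, hr.2.trans s.2.2⟩]
    have := hcontr.fixedPoint_unique hfix'
    rw [← hux' ⟨ha.trans_lt hs.1, hs.2⟩, this]

end Step

/-! ### Gluing across the impulses -/

section Induction

variable {E : Type*} [NormedAddCommGroup E] [NormedSpace ℝ E] {μ ν p T β L C l : ℝ}
  {Q R : ℝ → E →L[ℝ] E} {n : ℕ} {t : ℕ → ℝ} {φ : ℕ → ℝ → E → E} {F : ℝ → E → E} {α : ℝ → ℝ}
  {x₀ : E}

/-- The intervals are closed on the right, so `x` is left-continuous at each impulse time and
`x(t_i⁻)` can be replaced by `x(t_i)`. -/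
theorem WeightedBdd.leftLim_eq {a b : ℝ} (hab : a < b) {x : ℝ → E} (hx : WeightedBdd l a b x) :
    Function.leftLim x b = x b := by
  refine leftLim_eq_of_tendsto ?_
  rw [← nhdsWithin_Ioo_eq_nhdsLT hab]
  exact (hx.continuousOn b ⟨hab, le_rfl⟩).mono_left (nhdsWithin_mono _ Ioo_subset_Ioc_self)

theorem volterraRhs_congr {f f' x x' : ℝ → E} {s : ℝ} (hs : 0 ≤ s) (hf : f s = f' s)
    (hx : EqOn x x' (Ioc 0 s)) : volterraRhs μ R F f x s = volterraRhs μ R F f' x' s := by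
  rw [volterraRhs, volterraRhs, hf]
  congr 1
  refine intervalIntegral.integral_congr_ae (Eventually.of_forall fun r hr => ?_)
  rw [uIoc_of_le hs] at hr
  rw [hx hr]

/-- `S(s) x₀ + ∑_{i ≤ k} S(s - tᵢ) φᵢ(tᵢ, x(tᵢ))`. -/
def forcing (μ ν : ℝ) (Q : ℝ → E →L[ℝ] E) (t : ℕ → ℝ) (φ : ℕ → ℝ → E → E) (x₀ : E) (k : ℕ)
    (x : ℝ → E) (s : ℝ) : E :=
  S μ ν Q s x₀ + ∑ i ∈ Finset.Icc 1 k, S μ ν Q (s - t i) (φ i (t i) (x (t i)))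

/-- `x` solves the integral equation on `(0, t_m]`. -/
def IsSolutionUpTo (μ ν : ℝ) (Q R : ℝ → E →L[ℝ] E) (t : ℕ → ℝ) (φ : ℕ → ℝ → E → E)
    (F : ℝ → E → E) (x₀ : E) (m : ℕ) (x : ℝ → E) : Prop :=
  ∀ k < m, WeightedBdd (lam μ ν) (t k) (t (k + 1)) x ∧
    EqOn x (volterraRhs μ R F (forcing μ ν Q t φ x₀ k x) x) (Ioc (t k) (t (k + 1)))

theorem lam_le_one (hμ₁ : μ < 1) (hν₁ : ν ≤ 1) : lam μ ν ≤ 1 := by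
  rw [lam]; nlinarith [mul_nonneg (sub_nonneg.2 hμ₁.le) (sub_nonneg.2 hν₁)]

theorem IsPartition.nonneg (ht : IsPartition T n t) {k : ℕ} (hk : k ≤ n + 1) : 0 ≤ t k := by
  rw [← ht.zero]; exact ht.monotone (Nat.zero_le k) hk

theorem IsPartition.pos (ht : IsPartition T n t) {k : ℕ} (hk1 : 1 ≤ k) (hk : k ≤ n + 1) :
    0 < t k := by
  have h1 := ht.lt 0 (Nat.zero_le n)
  rw [ht.zero] at h1
  exact h1.trans_le (ht.monotone hk1 hk)

theorem IsPartition.le_last (ht : IsPartition T n t) {k : ℕ} (hk : k ≤ n + 1) : t k ≤ T := by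
  rw [← ht.last]; exact ht.monotone hk le_rfl

theorem weightedBdd_forcing (hμ₀ : 0 < μ) (hμ₁ : μ < 1) (hν₀ : 0 ≤ ν) (hν₁ : ν ≤ 1)
    (hQ : IsC0Semigroup Q) (hQb : IsUniformlyBounded Q) (ht : IsPartition T n t) {k : ℕ}
    (hk : k ≤ n) (x : ℝ → E) :
    WeightedBdd (lam μ ν) (t k) (t (k + 1)) (forcing μ ν Q t φ x₀ k x) := by
  have hl := lam_le_one hμ₁ hν₁
  have hS : ∀ (c : ℝ), c ≤ t k → ∀ w : E,
      WeightedBdd (lam μ ν) (t k) (t (k + 1)) fun s => S μ ν Q (s - c) w := by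
    intro c hc w
    obtain ⟨W, D, hW, hD, hSW⟩ := exists_eq_rpow_smul_S hμ₀ hμ₁ hν₀ hQ hQb w
    exact (weightedBdd_rpow_smul hl hc hW hD).congr fun s hs => hSW _ (by linarith [hs.1])
  refine WeightedBdd.add ?_ (weightedBdd_sum _ fun i hi => ?_)
  · simpa using hS 0 (ht.nonneg (by omega)) x₀
  · rw [Finset.mem_Icc] at hi
    exact hS (t i) (ht.monotone hi.2 (by omega)) _

/-- Impulses up to index `k` read `x` only at `t_1, …, t_k`. This causality turns the impulsive
problem into a sequence of equations with known forcing. -/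
theorem forcing_congr (ht : IsPartition T n t) {k : ℕ} (hk : k ≤ n) {x x' : ℝ → E}
    (hx : EqOn x x' (Ioc 0 (t k))) :
    forcing μ ν Q t φ x₀ k x = forcing μ ν Q t φ x₀ k x' := by
  funext s
  rw [forcing, forcing]
  congr 1
  refine Finset.sum_congr rfl fun i hi => ?_
  rw [Finset.mem_Icc] at hi
  rw [hx ⟨ht.pos hi.1 (by omega), ht.monotone hi.2 (by omega)⟩]

theorem IsSolutionUpTo.mono {m m' : ℕ} (hm : m ≤ m') {x : ℝ → E}
    (hx : IsSolutionUpTo μ ν Q R t φ F x₀ m' x) : IsSolutionUpTo μ ν Q R t φ F x₀ m x :=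
  fun k hk => hx k (hk.trans_le hm)

theorem IsSolutionUpTo.congr (ht : IsPartition T n t) {m : ℕ} (hm : m ≤ n + 1) {x x' : ℝ → E}
    (hx : IsSolutionUpTo μ ν Q R t φ F x₀ m x) (h : EqOn x' x (Ioc 0 (t m))) :
    IsSolutionUpTo μ ν Q R t φ F x₀ m x' := by
  intro k hk
  have hle : t (k + 1) ≤ t m := ht.monotone hk hm
  have hk0 : 0 ≤ t k := ht.nonneg (by omega)
  have h1 : EqOn x' x (Ioc (t k) (t (k + 1))) := h.mono (Ioc_subset_Ioc hk0 hle)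
  refine ⟨(hx k hk).1.congr h1, fun s hs => ?_⟩
  have hs0 : 0 ≤ s := hk0.trans hs.1.le
  rw [h1 hs, (hx k hk).2 hs]
  refine volterraRhs_congr hs0 ?_ (h.symm.mono (Ioc_subset_Ioc le_rfl (hs.2.trans hle)))
  rw [forcing_congr ht (by omega) (h.symm.mono (Ioc_subset_Ioc le_rfl (hs.1.le.trans (hs.2.trans hle))))]

theorem HypGo.growth_on {E : Type*} [NormedAddCommGroup E] {F : ℝ → E → E} {k : ℕ}
    (hF : HypGo l T n t p α β L F) (hk : k ≤ n) :
    ∀ᵐ s ∂(volume.restrict (Icc 0 T)), s ∈ Ioc (t k) (t (k + 1)) →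
      ∀ x, ‖F s x‖ ≤ α s + β * (s - t k) ^ (1 - l) * ‖x‖ := by
  filter_upwards [hF.growth] with s hs using hs k hk

theorem HypGo.lipschitz_on {E : Type*} [NormedAddCommGroup E] {F : ℝ → E → E} {k : ℕ}
    (hF : HypGo l T n t p α β L F) (hk : k ≤ n) :
    ∀ᵐ s ∂(volume.restrict (Icc 0 T)), s ∈ Ioc (t k) (t (k + 1)) →
      ∀ x y, ‖F s x - F s y‖ ≤ L * (s - t k) ^ (1 - l) * ‖x - y‖ := by
  filter_upwards [hF.lipschitz] with s hs using hs k hk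

theorem HypGo.memLp_comp (ht : IsPartition T n t) (hF : HypGo l T n t p α β L F) {m : ℕ}
    (hm : m ≤ n + 1) {x : ℝ → E} (hx : ∀ k < m, WeightedBdd l (t k) (t (k + 1)) x) :
    MemLp (fun r => F r (x r)) (ENNReal.ofReal p) (volume.restrict (Ioc 0 (t m))) := by
  induction m with
  | zero => simp [ht.zero]
  | succ m ih =>
    exact memLp_Ioc_union (ht.nonneg (by omega)) (ht.lt m (by omega)).le
      (ih (by omega) fun k hk => hx k (by omega))
      (memLp_superposition (ht.nonneg (by omega)) (ht.le_last hm) hF.measurable hF.continuous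
        hF.alpha_memLp (hF.growth_on (by omega)) hF.beta_pos.le (hx m (Nat.lt_succ_self m)))

/-- Induction on the number of intervals: uniqueness on `(0, t_m]` fixes the past and hence the
forcing on the next interval, where `existsUnique_volterra` applies. The base case is the empty
interval `(0, t_0]`. -/
theorem exists_unique_isSolutionUpTo [CompleteSpace E] (hμ₀ : 0 < μ) (hμ₁ : μ < 1) (hν₀ : 0 ≤ ν)
    (hν₁ : ν ≤ 1) (hp : 1 / μ < p) (hQ : IsC0Semigroup Q) (hQb : IsUniformlyBounded Q)
    (hC : 0 ≤ C) (hRC : ∀ s, ‖R s‖ ≤ C) (hRcont : ∀ x, Continuous fun s => R s x)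
    (ht : IsPartition T n t) (hF : HypGo (lam μ ν) T n t p α β L F) {m : ℕ} (hm : m ≤ n + 1) :
    ∃ x, IsSolutionUpTo μ ν Q R t φ F x₀ m x ∧
      ∀ y, IsSolutionUpTo μ ν Q R t φ F x₀ m y → EqOn y x (Ioc 0 (t m)) := by
  induction m with
  | zero => exact ⟨0, fun k hk => absurd hk (Nat.not_lt_zero k), fun y _ s hs => by
      rw [ht.zero] at hs; exact absurd (hs.1.trans_le hs.2) (lt_irrefl 0)⟩
  | succ m ih =>
    obtain ⟨x, hx, huniq⟩ := ih (by omega)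
    have hmn : m ≤ n := by omega
    have hm0 : 0 ≤ t m := ht.nonneg (by omega)
    obtain ⟨z, hzx, hzb, hzeq, hzuniq⟩ := existsUnique_volterra hμ₀ hμ₁ hp
      (lam_le_one hμ₁ hν₁) hm0 (ht.lt m hmn) (ht.le_last hm) hC hRC hRcont
      hF.measurable hF.continuous hF.alpha_memLp (hF.growth_on hmn) hF.beta_pos.le
      (hF.lipschitz_on hmn) hF.L_pos.le
      (weightedBdd_forcing (φ := φ) (x₀ := x₀) hμ₀ hμ₁ hν₀ hν₁ hQ hQb ht hmn x)
      (hF.memLp_comp ht (by omega) fun k hk => (hx k hk).1)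
    have hzx' : EqOn z x (Ioc 0 (t m)) := fun s hs => hzx hs.2
    refine ⟨z, fun k hk => ?_, fun y hy s hs => ?_⟩
    · rcases Nat.lt_succ_iff_lt_or_eq.1 hk with h | rfl
      · exact hx.congr ht (by omega) hzx' k h
      · refine ⟨hzb, ?_⟩
        rw [forcing_congr ht hmn hzx']
        exact hzeq
    · have hyx := huniq y (hy.mono (Nat.le_succ m))
      rcases le_or_gt s (t m) with h | h
      · rw [hyx ⟨hs.1, h⟩, hzx h]
      · refine hzuniq y hyx (hy m (Nat.lt_succ_self m)).1 ?_ ⟨h, hs.2⟩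
        rw [← forcing_congr ht hmn hyx]
        exact (hy m (Nat.lt_succ_self m)).2

theorem MemPC.forcing_eq (ht : IsPartition T n t) {x : ℝ → E} (hx : MemPC l n t x) {k : ℕ}
    (hk : k ≤ n) (s : ℝ) : forcing μ ν Q t φ x₀ k x s = S μ ν Q s x₀ +
      ∑ i ∈ Finset.Icc 1 k, S μ ν Q (s - t i) (φ i (t i) (Function.leftLim x (t i))) := by
  rw [forcing]
  congr 1
  refine Finset.sum_congr rfl fun i hi => ?_
  rw [Finset.mem_Icc] at hi
  obtain ⟨j, rfl⟩ : ∃ j, i = j + 1 := ⟨i - 1, by omega⟩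
  rw [WeightedBdd.leftLim_eq (ht.lt j (by omega)) (hx j (by omega))]

/-- The integrability clause of a mild solution is automatic: membership in the weighted space puts
`F(·, x(·))` in `L^p`, and Hölder does the rest. -/
theorem isMildSolution_iff (hμ₀ : 0 < μ) (hμ₁ : μ < 1) (hp : 1 / μ < p)
    (hPR : ∀ s, 0 ≤ s → ∀ x, P μ Q s x = R s x) (hRC : ∀ s, ‖R s‖ ≤ C)
    (hRcont : ∀ x, Continuous fun s => R s x) (ht : IsPartition T n t)
    (hF : HypGo (lam μ ν) T n t p α β L F) {x : ℝ → E} :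
    IsMildSolution μ ν Q n t φ F x₀ x ↔ IsSolutionUpTo μ ν Q R t φ F x₀ (n + 1) x := by
  have hker : ∀ s, 0 ≤ s → ∀ r ∈ uIoc 0 s, (s - r) ^ (μ - 1) • P μ Q (s - r) (F r (x r)) =
      (s - r) ^ (μ - 1) • R (s - r) (F r (x r)) := by
    intro s hs r hr
    rw [uIoc_of_le hs] at hr
    rw [hPR _ (by linarith [hr.2])]
  have hint : ∀ s, 0 ≤ s → ∫ r in (0 : ℝ)..s, (s - r) ^ (μ - 1) • P μ Q (s - r) (F r (x r)) =
      ∫ r in (0 : ℝ)..s, (s - r) ^ (μ - 1) • R (s - r) (F r (x r)) := fun s hs =>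
    intervalIntegral.integral_congr_ae (Eventually.of_forall fun r hr => hker s hs r hr)
  have hs0 : ∀ k ≤ n, ∀ s ∈ Ioc (t k) (t (k + 1)), 0 ≤ s := fun k hk s hs =>
    (ht.nonneg (by omega)).trans hs.1.le
  constructor
  · intro h k hk
    refine ⟨h.memPC k (by omega), fun s hs => ?_⟩
    rw [volterraRhs, h.memPC.forcing_eq ht (by omega), h.eq k (by omega) s hs,
      hint s (hs0 k (by omega) s hs)]
  · intro h
    have hPC : MemPC (lam μ ν) n t x := fun k hk => (h k (by omega)).1
    refine ⟨hPC, fun k hk s hs => ?_, fun k hk s hs => ?_⟩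
    · have hsT : s ∈ Icc 0 (t (n + 1)) :=
        ⟨hs0 k hk s hs, hs.2.trans (ht.monotone (by omega) le_rfl)⟩
      refine (intervalIntegrable_kernel_smul hμ₀ hμ₁ hp hRC hRcont
        (hF.memLp_comp ht le_rfl fun k hk => (h k hk).1) hsT).congr fun r hr => ?_
      exact (hker s hsT.1 r hr).symm
    · rw [hint s (hs0 k hk s hs), ← hPC.forcing_eq ht hk]
      exact (h k (by omega)).2 hs

end Induction

end HilferRelax

end

theorem mainTheorem4
    {E : Type*} [NormedAddCommGroup E] [NormedSpace ℝ E] [CompleteSpace E]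
    {Λ : Type*} [TopologicalSpace Λ] [PolishSpace Λ] [CompactSpace Λ]
    [MeasurableSpace Λ] [BorelSpace Λ]
    (μ ν : ℝ) (hμ₀ : 0 < μ) (hμ₁ : μ < 1) (hν₀ : 0 ≤ ν) (hν₁ : ν ≤ 1)
    (A : E →ₗ.[ℝ] E) (Q : ℝ → E →L[ℝ] E)
    (hQ : IsC0Semigroup Q) (hA : IsGenerator A Q)
    (hQc : IsCompactSemigroup Q) (hQb : IsUniformlyBounded Q)
    (T : ℝ) (n : ℕ) (t : ℕ → ℝ) (ht : IsPartition T n t)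
    (g : ℝ → E → Λ → E) (p : ℝ) (hp : 1 / μ < p) (α : ℝ → ℝ) (β L : ℝ)
    (hg : HypGr (lam μ ν) T n t p α β L g)
    (φ : ℕ → ℝ → E → E) (h : ℕ → ℝ) (hh : HypH (lam μ ν) Q n t φ h) :
    ∃ (α' : ℝ → ℝ) (β' L' : ℝ), ∀ v : ℝ → Measure Λ, IsRelaxedControl T v →
      HypGo (lam μ ν) T n t p α' β' L' (relaxedRhs g v) ∧
      ∀ x₀ : E, ∃ x : ℝ → E,
        IsMildSolution μ ν Q n t φ (relaxedRhs g v) x₀ x ∧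
        ∀ y : ℝ → E, IsMildSolution μ ν Q n t φ (relaxedRhs g v) x₀ y →
          EqOn y x (Ioc 0 T) := by
  obtain ⟨R, C, hC, hPR, hRC, hRcont⟩ := exists_continuousLinearMap_eq_P hμ₀ hμ₁ hQ hQb
  -- The data are fixed before `v`, which gives the required independence of the control.
  refine ⟨α, β + 1, L, fun v hv => ?_⟩
  have hF := hg.relaxedRhs ht hv
  refine ⟨hF, fun x₀ => ?_⟩
  obtain ⟨x, hx, huniq⟩ := exists_unique_isSolutionUpTo (φ := φ) (x₀ := x₀) hμ₀ hμ₁ hν₀ hν₁ hp hQ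
    hQb hC hRC hRcont ht hF le_rfl
  refine ⟨x, (isMildSolution_iff hμ₀ hμ₁ hp hPR hRC hRcont ht hF).2 hx, fun y hy => ?_⟩
  rw [← ht.last]
  exact huniq y ((isMildSolution_iff hμ₀ hμ₁ hp hPR hRC hRcont ht hF).1 hy)
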